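/- Let $n,m,q\in\mathbb N$, $A,N_1,\dots,N_m\in\mathbb R^{n\times n}$, $X_0\in\mathbb R^{n\times q}$ and $\gamma>0$. For symmetric matrices write $M_1\le M_2$ if $M_2-M_1$ is positive semidefinite, let $\sigma(\cdot)\subset\mathbb C$ denote the spectrum, and put $\mathbb C_-=\{z\in\mathbb C:\operatorname{Re} z<0\}$ with closure $\overline{\mathbb C_-}$. Let $Z_\gamma(\cdot,X_0X_0^\top)$ be the solution on $[0,\infty)$ of $$\dot Z(t)=AZ(t)+Z(t)A^\top+\frac1{\gamma^2}\sum_{k=1}^m N_kZ(t)N_k^\top,\qquad Z(0)=X_0X_0^\top .\tag{1}$$ For a control $u\in L^2([0,\infty);\mathbb R^m)$ let $\Phi$ be the fundamental solution of the bilinear system with coefficients $A,N_k$, i.e. the continuous matrix function with $$\Phi(t)=I+\int_0^t A\Phi(v)\,dv+\sum_{k=1}^m\int_0^t N_k\Phi(v)u_k(v)\,dv,\qquad t\ge0 .$$ Suppose that there is a symmetric positive definite matrix $X\in\mathbb R^{n\times n}$ with $$AX+XA^\top+\frac1{\gamma^2}\sum_{k=1}^m N_kXN_k^\top\le -X_0X_0^\top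 .$$ Then: 1. $\sigma\Big(I\otimes A+A\otimes I+\frac1{\gamma^2}\sum_{k=1}^m N_k\otimes N_k\Big)\subset\overline{\mathbb C_-}$. 2. There are constants $c>0$ and $C$ with $\|Z_\gamma(t,X_0X_0^\top)\|_2\le C e^{-ct}$ for all $t\ge0$, where $\|\cdot\|_2$ is the spectral norm. 3. There are an integer $0\le\tilde n\le n$ and a matrix $V\in\mathbb R^{n\times\tilde n}$ with $V^\top V=I$ (neither depending on the control $u$) such that, with $\tilde A=V^\top AV$, $\tilde N_k=V^\top N_kV$ and $\tilde X_0=V^\top X_0$, $$\sigma\Big(I\otimes\tilde A+\tilde A\otimes I+\frac1{\gamma^2}\sum_{k=1}^m\tilde N_k\otimes\tilde N_k\Big)\subset\mathbb C_- ,$$ and, for every $u\in L^2([0,\infty);\mathbb R^m)$, the fundamental solutions $\Phi$ and $\tilde\Phi$ of the bilinear systems with coefficients $A,N_k$ and $\tilde A,\tilde N_k$ (and the same control $u$) satisfy $$\Phi(t)X_0=V\tilde\Phi(t)\tilde X_0\qquad\text{for all }t\ge0 .$$ -/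

import Mathlib

open MeasureTheory
open scoped Kronecker Matrix Matrix.Norms.L2Operator

/- The scope `Matrix.Norms.L2Operator` makes `‖M‖` the spectral norm `‖M‖₂` of a matrix. -/

namespace BilinearSystem

/-- The open left half-plane `ℂ₋`. -/
def leftHalfPlane : Set ℂ := {z : ℂ | z.re < 0}

/-- The generalized Lyapunov operator
`X ↦ A X + X Aᵀ + γ⁻² ∑ₖ Nₖ X Nₖᵀ`. -/
noncomputable def lyapunovOp {n m : ℕ} (A : Matrix (Fin n) (Fin n) ℝ)
    (N : Fin m → Matrix (Fin n) (Fin n) ℝ) (γ : ℝ) (X : Matrix (Fin n) (Fin n) ℝ) :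
    Matrix (Fin n) (Fin n) ℝ :=
  A * X + X * Aᵀ + (1 / γ ^ 2) • ∑ k, N k * X * (N k)ᵀ

/-- The Kronecker matrix `I ⊗ A + A ⊗ I + γ⁻² ∑ₖ Nₖ ⊗ Nₖ`. -/
noncomputable def kroneckerOp {n m : ℕ} (A : Matrix (Fin n) (Fin n) ℝ)
    (N : Fin m → Matrix (Fin n) (Fin n) ℝ) (γ : ℝ) :
    Matrix (Fin n × Fin n) (Fin n × Fin n) ℝ :=
  1 ⊗ₖ A + A ⊗ₖ 1 + (1 / γ ^ 2) • ∑ k, N k ⊗ₖ N k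

/-- The spectrum `σ(M) ⊆ ℂ` of a real square matrix. -/
def complexSpectrum {ι : Type*} [Fintype ι] [DecidableEq ι] (M : Matrix ι ι ℝ) : Set ℂ :=
  spectrum ℂ (M.map (fun x : ℝ => (x : ℂ)))

/-- `Z` solves `Z' = A Z + Z Aᵀ + γ⁻² ∑ₖ Nₖ Z Nₖᵀ` on `[0, ∞)` with `Z(0) = K`
(the derivative at `0` is one-sided). -/
def IsLyapunovFlow {n m : ℕ} (A : Matrix (Fin n) (Fin n) ℝ)
    (N : Fin m → Matrix (Fin n) (Fin n) ℝ) (γ : ℝ) (K : Matrix (Fin n) (Fin n) ℝ)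
    (Z : ℝ → Matrix (Fin n) (Fin n) ℝ) : Prop :=
  Z 0 = K ∧ ∀ t : ℝ, 0 ≤ t → HasDerivWithinAt Z (lyapunovOp A N γ (Z t)) (Set.Ici 0) t

/-- The control `u` belongs to `L²([0, ∞); ℝᵐ)`. -/
def IsL2Control {m : ℕ} (u : ℝ → EuclideanSpace ℝ (Fin m)) : Prop :=
  MemLp u 2 (volume.restrict (Set.Ici 0))

/-- `Φ = Φ(·, s)` is the fundamental solution, started at time `s`, of the bilinear system with
coefficients `A`, `Nₖ` and control `u`:
`Φ(t, s) = I + ∫ₛᵗ A Φ(v, s) dv + ∑ₖ ∫ₛᵗ Nₖ Φ(v, s) uₖ(v) dv` for `t ≥ s`.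
Continuity of `Φ(·, s)` on `[s, ∞)` is required so that, for a control in `L²`, the integrands are
integrable and the integrals are meaningful. -/
def IsFundamentalSolution {n m : ℕ} (A : Matrix (Fin n) (Fin n) ℝ)
    (N : Fin m → Matrix (Fin n) (Fin n) ℝ) (u : ℝ → EuclideanSpace ℝ (Fin m)) (s : ℝ)
    (Φ : ℝ → Matrix (Fin n) (Fin n) ℝ) : Prop :=
  ContinuousOn Φ (Set.Ici s) ∧
    ∀ t : ℝ, s ≤ t →
      Φ t = 1 + (∫ v in s..t, A * Φ v) + ∑ k, ∫ v in s..t, (u v k) • (N k * Φ v)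

end BilinearSystem

/-!
The proof is purely finite-dimensional. Write `L` for the Lyapunov operator, with `γ⁻¹` absorbed
into the `Nₖ`. The basic observation (`kernel_invariant_of_lyap_nonpos`) is that a positive
semidefinite `H` with `L H ≤ 0` has a kernel which is invariant under `Aᴴ` and all `Nₖᴴ` and on
which `L H` vanishes: on a kernel vector the drift terms drop out of the quadratic form of `L H`,
and the remaining terms are nonnegative.

*Spectrum.* Let `X > 0` satisfy the Lyapunov inequality and let `L M = z M` with `M ≠ 0` and
`0 ≤ re z`. For a suitable `s` the block matrix `H = [X, s M; s Mᴴ, X]` is positive semidefinite and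
singular. It satisfies a Lyapunov inequality for the doubled system with drift
`diag (A - z / 2, A - z̄ / 2)`, because this shift cancels the off-diagonal blocks. The basic
observation then gives `re z = 0` together with a nonzero subspace, invariant under the adjoint
coefficients, on which `L X` and hence `X₀ᵀ` vanishes (`eigenvalue_obstruction`). Its annihilator is
a proper subspace that is invariant under `A` and all `Nₖ` and contains the columns of `X₀`
(`exists_invariant_of_eigenvalue`).

*Reduction.* Let `V` be an orthonormal basis of the smallest subspace that is invariant under `A`
and all `Nₖ` and contains the columns of `X₀` (`exists_reachable_coordinates`). The inequality
passes to the reduced system with `(Vᵀ X⁻¹ V)⁻¹` in place of `X`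
(`exists_reduced_lyapunov_inequality`), and by minimality no eigenvalue of the reduced operator has
nonnegative real part. Since the subspace is invariant, `Φ X₀` and `V Φᵣ Vᵀ X₀` solve the same
linear Volterra equation, whose solution is unique (`eq_zero_of_norm_le_integral`).

*Decay.* The reduced operator is injective, so the reduced `X` can be perturbed to a `Y > 0` with
`L Y < -c Y` (`exists_strict_lyapunov`). A comparison principle for the differential Lyapunov
inequality (`posDef_of_strict_differential_inequality`) bounds the reduced flow by a multiple of
`exp (-c t) Y` from both sides, and the full flow is `V Z Vᵀ` with `Z` the reduced one.
-/

namespace BilinearSystem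

open scoped ComplexOrder

/-- The generalized Lyapunov operator `X ↦ A X + X Aᴴ + ∑ₖ Nₖ X Nₖᴴ` over `ℝ` or `ℂ`, as a linear
map. The weight `γ⁻²` of `lyapunovOp` is absorbed into the `Nₖ`. -/
def lyap {ι κ 𝕜 : Type*} [Fintype ι] [Fintype κ] [RCLike 𝕜] (A : Matrix ι ι 𝕜)
    (N : κ → Matrix ι ι 𝕜) : Matrix ι ι 𝕜 →ₗ[𝕜] Matrix ι ι 𝕜 where
  toFun X := A * X + X * Aᴴ + ∑ k, N k * X * (N k)ᴴ
  map_add' X Y := by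
    simp only [Matrix.mul_add, Matrix.add_mul, Finset.sum_add_distrib]
    abel
  map_smul' c X := by
    simp only [Matrix.mul_smul, Matrix.smul_mul, smul_add, Finset.smul_sum, RingHom.id_apply]

/-! ### Positivity of the Lyapunov operator -/

section Positivity

variable {ι κ 𝕜 : Type*} [Fintype ι] [Fintype κ] [RCLike 𝕜]

lemma lyap_apply (A : Matrix ι ι 𝕜) (N : κ → Matrix ι ι 𝕜) (X : Matrix ι ι 𝕜) :
    lyap A N X = A * X + X * Aᴴ + ∑ k, N k * X * (N k)ᴴ := rfl

lemma lyap_conjTranspose (A : Matrix ι ι 𝕜) (N : κ → Matrix ι ι 𝕜) (X : Matrix ι ι 𝕜) :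
    (lyap A N X)ᴴ = lyap A N Xᴴ := by
  simp only [lyap_apply, Matrix.conjTranspose_add, Matrix.conjTranspose_mul,
    Matrix.conjTranspose_sum, Matrix.conjTranspose_conjTranspose, Matrix.mul_assoc]
  abel

lemma star_dotProduct_mul_mul_conjTranspose (B H : Matrix ι ι 𝕜) (v : ι → 𝕜) :
    star v ⬝ᵥ ((B * H * Bᴴ) *ᵥ v) = star (Bᴴ *ᵥ v) ⬝ᵥ (H *ᵥ (Bᴴ *ᵥ v)) := by
  rw [Matrix.star_mulVec, Matrix.conjTranspose_conjTranspose, ← Matrix.mulVec_mulVec,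
    ← Matrix.mulVec_mulVec, Matrix.dotProduct_mulVec]

/-- On a vector killed by `H` from both sides, the drift terms of the Lyapunov operator do not
contribute to the quadratic form. -/
lemma star_dotProduct_lyap_mulVec {A : Matrix ι ι 𝕜} {N : κ → Matrix ι ι 𝕜} {H : Matrix ι ι 𝕜}
    (hH : H.IsHermitian) {v : ι → 𝕜} (hv : H *ᵥ v = 0) :
    star v ⬝ᵥ (lyap A N H *ᵥ v) =
      ∑ k, star ((N k)ᴴ *ᵥ v) ⬝ᵥ (H *ᵥ ((N k)ᴴ *ᵥ v)) := by
  have h1 : star v ⬝ᵥ (H *ᵥ (Aᴴ *ᵥ v)) = 0 := by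
    have : star v ᵥ* H = 0 := by
      have := congrArg star hv
      rwa [Matrix.star_mulVec, hH.eq, star_zero] at this
    rw [Matrix.dotProduct_mulVec, this, zero_dotProduct]
  rw [lyap_apply, Matrix.add_mulVec, Matrix.add_mulVec, ← Matrix.mulVec_mulVec, hv,
    ← Matrix.mulVec_mulVec, dotProduct_add, dotProduct_add, h1, Matrix.sum_mulVec, dotProduct_sum]
  simp [star_dotProduct_mul_mul_conjTranspose]

/-- If `H ≥ 0` satisfies the Lyapunov inequality `lyap A N H ≤ 0`, then the kernel of `H` is
invariant under the adjoint coefficients and is contained in the kernel of `lyap A N H`. -/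
lemma kernel_invariant_of_lyap_nonpos {A : Matrix ι ι 𝕜} {N : κ → Matrix ι ι 𝕜}
    {H : Matrix ι ι 𝕜} (hH : H.PosSemidef) (hL : (-lyap A N H).PosSemidef) {v : ι → 𝕜}
    (hv : H *ᵥ v = 0) :
    H *ᵥ (Aᴴ *ᵥ v) = 0 ∧ (∀ k, H *ᵥ ((N k)ᴴ *ᵥ v) = 0) ∧ lyap A N H *ᵥ v = 0 := by
  have hq := star_dotProduct_lyap_mulVec (A := A) (N := N) hH.1 hv
  have hpos : ∀ k ∈ Finset.univ, 0 ≤ star ((N k)ᴴ *ᵥ v) ⬝ᵥ (H *ᵥ ((N k)ᴴ *ᵥ v)) :=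
    fun k _ => hH.dotProduct_mulVec_nonneg _
  have hle := hL.dotProduct_mulVec_nonneg v
  rw [Matrix.neg_mulVec, dotProduct_neg, hq, neg_nonneg] at hle
  have h0 := le_antisymm hle (Finset.sum_nonneg hpos)
  have hN : ∀ k, H *ᵥ ((N k)ᴴ *ᵥ v) = 0 := fun k =>
    (hH.dotProduct_mulVec_zero_iff _).1 ((Finset.sum_eq_zero_iff_of_nonneg hpos).1 h0 k
      (Finset.mem_univ k))
  have hLv : lyap A N H *ᵥ v = 0 := by
    have := (hL.dotProduct_mulVec_zero_iff v).1 (by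
      rw [Matrix.neg_mulVec, dotProduct_neg, hq, h0, neg_zero])
    rwa [Matrix.neg_mulVec, neg_eq_zero] at this
  refine ⟨?_, hN, hLv⟩
  have h2 := hLv
  rw [lyap_apply, Matrix.add_mulVec, Matrix.add_mulVec, ← Matrix.mulVec_mulVec, hv,
    ← Matrix.mulVec_mulVec, Matrix.sum_mulVec] at h2
  have h3 : ∀ k, (N k * H * (N k)ᴴ) *ᵥ v = 0 := fun k => by
    rw [← Matrix.mulVec_mulVec, ← Matrix.mulVec_mulVec, hN k, Matrix.mulVec_zero]
  simpa [h3] using h2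

/-- Two quadratic forms, one of them positive definite, have a vector at which their quotient is
maximal. -/
lemma exists_isMax_quotient {P Q : Matrix ι ι 𝕜} (hP : P.PosDef) [Nonempty ι] :
    ∃ v : ι → 𝕜, v ≠ 0 ∧ ∀ w : ι → 𝕜,
      RCLike.re (star w ⬝ᵥ (Q *ᵥ w)) * RCLike.re (star v ⬝ᵥ (P *ᵥ v)) ≤
        RCLike.re (star v ⬝ᵥ (Q *ᵥ v)) * RCLike.re (star w ⬝ᵥ (P *ᵥ w)) := by
  have hc : ∀ M : Matrix ι ι 𝕜,
      Continuous fun w : ι → 𝕜 => RCLike.re (star w ⬝ᵥ (M *ᵥ w)) := fun M => by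
    refine RCLike.continuous_re.comp ?_
    exact Continuous.dotProduct continuous_star (Continuous.matrix_mulVec continuous_const
      continuous_id)
  have hp : ∀ w : ι → 𝕜, w ≠ 0 → 0 < RCLike.re (star w ⬝ᵥ (P *ᵥ w)) := fun w hw =>
    (RCLike.pos_iff.1 (hP.dotProduct_mulVec_pos hw)).1
  have hsph : ∀ w ∈ Metric.sphere (0 : ι → 𝕜) 1, w ≠ 0 := fun w hw h => by
    simp [h] at hw
  obtain ⟨v, hv, hmax⟩ := (isCompact_sphere (0 : ι → 𝕜) 1).exists_isMaxOn
    (NormedSpace.sphere_nonempty.2 zero_le_one)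
    (f := fun w => RCLike.re (star w ⬝ᵥ (Q *ᵥ w)) / RCLike.re (star w ⬝ᵥ (P *ᵥ w)))
    (((hc Q).continuousOn).div (hc P).continuousOn fun w hw => (hp w (hsph w hw)).ne')
  refine ⟨v, hsph v hv, fun w => ?_⟩
  rcases eq_or_ne w 0 with rfl | hw
  · simp
  -- normalise `w`; both forms are homogeneous of degree two
  have hscale : ∀ M : Matrix ι ι 𝕜, RCLike.re (star ((((‖w‖⁻¹ : ℝ) : 𝕜)) • w) ⬝ᵥ
      (M *ᵥ ((((‖w‖⁻¹ : ℝ) : 𝕜)) • w))) = (‖w‖⁻¹ * ‖w‖⁻¹) * RCLike.re (star w ⬝ᵥ (M *ᵥ w)) := by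
    intro M
    rw [star_smul, Matrix.mulVec_smul, smul_dotProduct, dotProduct_smul, smul_smul]
    rw [RCLike.star_def, RCLike.conj_ofReal, ← RCLike.ofReal_mul, smul_eq_mul, RCLike.re_ofReal_mul]
  have hn : 0 < ‖w‖ := norm_pos_iff.2 hw
  have h1 := hmax (show (((‖w‖⁻¹ : ℝ) : 𝕜)) • w ∈ Metric.sphere (0 : ι → 𝕜) 1 by
    rw [mem_sphere_zero_iff_norm, norm_smul, RCLike.norm_ofReal, abs_of_pos (inv_pos.2 hn),
      inv_mul_cancel₀ hn.ne'])
  simp only [Set.mem_ofPred_eq, hscale] at h1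
  rw [mul_div_mul_left _ _ (mul_pos (inv_pos.2 hn) (inv_pos.2 hn)).ne',
    div_le_div_iff₀ (hp w hw) (hp v (hsph v hv))] at h1
  exact h1

/-- A positive definite matrix perturbed along a Hermitian direction in which the quadratic form
takes a negative value becomes singular while it is still positive semidefinite. -/
lemma exists_posSemidef_singular {P Q : Matrix ι ι 𝕜} (hP : P.PosDef) (hQ : Q.IsHermitian)
    {w : ι → 𝕜} (hw : RCLike.re (star w ⬝ᵥ (Q *ᵥ w)) < 0) :
    ∃ s : ℝ, (P + (s : 𝕜) • Q).PosSemidef ∧ ∃ v : ι → 𝕜, v ≠ 0 ∧ (P + (s : 𝕜) • Q) *ᵥ v = 0 := by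
  have hw0 : w ≠ 0 := by
    rintro rfl
    simp at hw
  have : Nonempty ι := by
    by_contra h
    rw [not_nonempty_iff] at h
    exact hw0 (Subsingleton.elim _ _)
  obtain ⟨v, hv, hmax⟩ := exists_isMax_quotient (Q := -Q) hP
  have hp : ∀ w : ι → 𝕜, w ≠ 0 → 0 < RCLike.re (star w ⬝ᵥ (P *ᵥ w)) := fun w hw =>
    (RCLike.pos_iff.1 (hP.dotProduct_mulVec_pos hw)).1
  simp only [Matrix.neg_mulVec, dotProduct_neg, map_neg] at hmax
  have hvneg : RCLike.re (star v ⬝ᵥ (Q *ᵥ v)) < 0 := by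
    have := hmax w
    have h1 := hp w hw0
    have h2 := hp v hv
    by_contra hcon
    nlinarith [mul_pos (neg_pos.2 hw) h2, mul_nonneg (not_lt.1 hcon) h1.le]
  set p := RCLike.re (star v ⬝ᵥ (P *ᵥ v)) with hpdef
  set d := RCLike.re (star v ⬝ᵥ (Q *ᵥ v)) with hddef
  -- `s = -p / d` makes the form of `P + s Q` vanish at the maximiser `v`
  have hform : ∀ x : ι → 𝕜, RCLike.re (star x ⬝ᵥ ((P + ((-(p / d) : ℝ) : 𝕜) • Q) *ᵥ x)) =
      RCLike.re (star x ⬝ᵥ (P *ᵥ x)) - p / d * RCLike.re (star x ⬝ᵥ (Q *ᵥ x)) := fun x => by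
    rw [Matrix.add_mulVec, dotProduct_add, map_add, Matrix.smul_mulVec, dotProduct_smul,
      smul_eq_mul, RCLike.re_ofReal_mul]
    ring
  have hherm : (P + ((-(p / d) : ℝ) : 𝕜) • Q).IsHermitian := by
    refine hP.1.add ?_
    rw [Matrix.IsHermitian, Matrix.conjTranspose_smul, hQ.eq, RCLike.star_def, RCLike.conj_ofReal]
  have him : ∀ x : ι → 𝕜, RCLike.im (star x ⬝ᵥ ((P + ((-(p / d) : ℝ) : 𝕜) • Q) *ᵥ x)) = 0 :=
    fun x => hherm.im_star_dotProduct_mulVec_self x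
  have hpsd : (P + ((-(p / d) : ℝ) : 𝕜) • Q).PosSemidef := by
    refine Matrix.PosSemidef.of_dotProduct_mulVec_nonneg hherm fun x => ?_
    refine RCLike.nonneg_iff.2 ⟨?_, him x⟩
    rw [hform]
    have h := hmax x
    have : p / d * RCLike.re (star x ⬝ᵥ (Q *ᵥ x)) = (RCLike.re (star x ⬝ᵥ (Q *ᵥ x)) * p) / d := by
      ring
    rw [this, sub_nonneg, div_le_iff_of_neg hvneg]
    linarith
  refine ⟨-(p / d), hpsd, v, hv, ?_⟩
  rw [← hpsd.dotProduct_mulVec_zero_iff]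
  refine RCLike.ext ?_ ?_
  · rw [hform, ← hpdef, ← hddef, div_mul_cancel₀ _ hvneg.ne]
    simp
  · simpa using him v

/-- The real part of any quadratic form is dominated by a multiple of a positive definite one. -/
lemma exists_abs_form_le {P : Matrix ι ι 𝕜} (hP : P.PosDef) (Q : Matrix ι ι 𝕜) :
    ∃ C : ℝ, 0 < C ∧ ∀ w : ι → 𝕜, |RCLike.re (star w ⬝ᵥ (Q *ᵥ w))| ≤
      C * RCLike.re (star w ⬝ᵥ (P *ᵥ w)) := by
  cases isEmpty_or_nonempty ι
  · exact ⟨1, one_pos, fun w => by simp [dotProduct]⟩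
  have hone : ∀ Q : Matrix ι ι 𝕜, ∃ C : ℝ, ∀ w : ι → 𝕜, RCLike.re (star w ⬝ᵥ (Q *ᵥ w)) ≤
      C * RCLike.re (star w ⬝ᵥ (P *ᵥ w)) := fun Q => by
    obtain ⟨v, hv, hmax⟩ := exists_isMax_quotient (Q := Q) hP
    have h2 := (RCLike.pos_iff.1 (hP.dotProduct_mulVec_pos hv)).1
    refine ⟨RCLike.re (star v ⬝ᵥ (Q *ᵥ v)) / RCLike.re (star v ⬝ᵥ (P *ᵥ v)), fun w => ?_⟩
    rw [div_mul_eq_mul_div, le_div_iff₀ h2]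
    exact hmax w
  obtain ⟨C₁, h₁⟩ := hone Q
  obtain ⟨C₂, h₂⟩ := hone (-Q)
  refine ⟨max (max C₁ C₂) 1, by positivity, fun w => ?_⟩
  have hp : 0 ≤ RCLike.re (star w ⬝ᵥ (P *ᵥ w)) :=
    (RCLike.nonneg_iff.1 (hP.posSemidef.dotProduct_mulVec_nonneg w)).1
  have h2 := h₂ w
  rw [Matrix.neg_mulVec, dotProduct_neg, map_neg] at h2
  refine abs_le'.2 ⟨(h₁ w).trans ?_, h2.trans ?_⟩ <;> gcongr <;> simp

end Positivity

/-! ### Eigenvalues in the closed right half-plane -/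

section Doubling

variable {ι κ : Type*} [Fintype ι] [Fintype κ]

/-- The Lyapunov operator of the doubled system with drift `diag (A - z / 2, A - z̄ / 2)`. The
shifts add up to `z` on the off-diagonal blocks and to `re z` on the diagonal ones. -/
lemma lyap_fromBlocks (A : Matrix ι ι ℂ) (N : κ → Matrix ι ι ℂ) (X M : Matrix ι ι ℂ) (z : ℂ)
    [DecidableEq ι] :
    lyap (Matrix.fromBlocks (A - (z / 2) • 1) 0 0 (A - (star z / 2) • 1))
        (fun k => Matrix.fromBlocks (N k) 0 0 (N k)) (Matrix.fromBlocks X M Mᴴ X) =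
      Matrix.fromBlocks (lyap A N X - (z.re : ℂ) • X) (lyap A N M - z • M)
        (lyap A N M - z • M)ᴴ (lyap A N X - (z.re : ℂ) • X) := by
  have hre : z / 2 + star z / 2 = (z.re : ℂ) := by
    rw [← add_div, Complex.star_def, Complex.add_conj]
    push_cast
    ring
  have hsum : ∀ f g h l : κ → Matrix ι ι ℂ, ∑ k, Matrix.fromBlocks (f k) (g k) (h k) (l k) =
      Matrix.fromBlocks (∑ k, f k) (∑ k, g k) (∑ k, h k) (∑ k, l k) := fun f g h l => by
    ext (i | i) (j | j) <;> simp [Matrix.sum_apply]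
  rw [Matrix.conjTranspose_sub, lyap_conjTranspose, Matrix.conjTranspose_smul]
  simp only [lyap_apply, Matrix.fromBlocks_conjTranspose, Matrix.fromBlocks_multiply,
    Matrix.conjTranspose_sub, Matrix.conjTranspose_smul, Matrix.conjTranspose_one,
    Matrix.conjTranspose_zero, Matrix.zero_mul, Matrix.mul_zero, add_zero, zero_add, hsum,
    Matrix.fromBlocks_add, Matrix.sub_mul, Matrix.mul_sub, Matrix.smul_mul, Matrix.mul_smul,
    Matrix.one_mul, Matrix.mul_one, star_div₀, star_star, star_ofNat]
  congr 1
  · rw [← hre, add_smul]; abel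
  · rw [show z • M = (z / 2) • M + (z / 2) • M by rw [← add_smul, add_halves]]; abel
  · rw [show star z • Mᴴ = (star z / 2) • Mᴴ + (star z / 2) • Mᴴ by rw [← add_smul, add_halves]]
    abel
  · rw [← hre, add_smul]; abel

/-- Let `X > 0` satisfy `lyap A N X ≤ 0`. An eigenvalue `z` with `0 ≤ re z` of the Lyapunov operator
lies on the imaginary axis, and it forces a nonzero common invariant subspace of `Aᴴ` and the `Nₖᴴ`
on which `lyap A N X` vanishes. For an eigenvector `M`, the subspace is read off from the kernel of
a singular positive semidefinite block matrix `[X, s M; s Mᴴ, X]`. -/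
lemma eigenvalue_obstruction [DecidableEq ι] {A : Matrix ι ι ℂ} {N : κ → Matrix ι ι ℂ}
    {X M : Matrix ι ι ℂ} (hX : X.PosDef) (hL : (-lyap A N X).PosSemidef) {z : ℂ} (hM : M ≠ 0)
    (hz : lyap A N M = z • M) (hre : 0 ≤ z.re) :
    z.re = 0 ∧ ∃ E : Submodule ℂ (ι → ℂ), E ≠ ⊥ ∧ ∀ v ∈ E, Aᴴ *ᵥ v ∈ E ∧
      (∀ k, (N k)ᴴ *ᵥ v ∈ E) ∧ lyap A N X *ᵥ v = 0 := by
  have hXX : (Matrix.fromBlocks X 0 0 X).PosDef := by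
    refine Matrix.PosDef.of_dotProduct_mulVec_pos (by
      rw [Matrix.IsHermitian, Matrix.fromBlocks_conjTranspose]; simp [hX.1.eq]) fun v hv => ?_
    obtain ⟨a, b, rfl⟩ : ∃ a b, v = Sum.elim a b := ⟨v ∘ Sum.inl, v ∘ Sum.inr, by simp⟩
    have hs : star (Sum.elim a b) = Sum.elim (star a) (star b) := by
      ext (i | i) <;> rfl
    rw [Matrix.fromBlocks_mulVec, hs, sumElim_dotProduct_sumElim]
    simp only [Matrix.zero_mulVec, add_zero, zero_add, Sum.elim_comp_inl, Sum.elim_comp_inr]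
    rcases eq_or_ne a 0 with rfl | ha
    · have hb : b ≠ 0 := by
        rintro rfl
        exact hv (by ext (i | i) <;> rfl)
      simpa using hX.dotProduct_mulVec_pos hb
    · exact add_pos_of_pos_of_nonneg (hX.dotProduct_mulVec_pos ha)
        (hX.posSemidef.dotProduct_mulVec_nonneg b)
  obtain ⟨b, hb⟩ : ∃ b, M *ᵥ b ≠ 0 := by
    by_contra! h
    refine hM (Matrix.ext_of_mulVec_single fun i => ?_)
    rw [h, Matrix.zero_mulVec]
  have hQ : (Matrix.fromBlocks 0 M Mᴴ 0).IsHermitian := by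
    rw [Matrix.IsHermitian, Matrix.fromBlocks_conjTranspose]; simp
  -- the off-diagonal part is negative at `(-M b, b)`
  have hneg : RCLike.re (star (Sum.elim (-(M *ᵥ b)) b) ⬝ᵥ
      (Matrix.fromBlocks 0 M Mᴴ 0 *ᵥ Sum.elim (-(M *ᵥ b)) b)) < 0 := by
    have hs : star (Sum.elim (-(M *ᵥ b)) b) = Sum.elim (star (-(M *ᵥ b))) (star b) := by
      ext (i | i) <;> rfl
    have hpos : 0 < star (M *ᵥ b) ⬝ᵥ (M *ᵥ b) := Matrix.dotProduct_star_self_pos_iff.2 hb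
    have h2 : star b ⬝ᵥ (Mᴴ *ᵥ (M *ᵥ b)) = star (M *ᵥ b) ⬝ᵥ (M *ᵥ b) := by
      rw [Matrix.dotProduct_mulVec, ← Matrix.star_mulVec]
    rw [Matrix.fromBlocks_mulVec, hs, sumElim_dotProduct_sumElim]
    simp only [Matrix.zero_mulVec, add_zero, Sum.elim_comp_inl, Sum.elim_comp_inr, zero_add,
      neg_zero, Matrix.mulVec_neg, dotProduct_neg, star_neg, neg_dotProduct, h2, map_add, map_neg]
    have := (RCLike.pos_iff.1 hpos).1
    linarith
  obtain ⟨s, hH, v₀, hv₀, hHv₀⟩ := exists_posSemidef_singular hXX hQ hneg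
  set M' := (s : ℂ) • M with hM'
  have hHeq : Matrix.fromBlocks X 0 0 X + (s : ℂ) • Matrix.fromBlocks 0 M Mᴴ 0 =
      Matrix.fromBlocks X M' M'ᴴ X := by
    rw [Matrix.fromBlocks_smul, Matrix.fromBlocks_add]
    simp [hM', Matrix.conjTranspose_smul]
  have hHeq' : Matrix.fromBlocks X 0 0 X + ((RCLike.ofReal s : ℂ)) • Matrix.fromBlocks 0 M Mᴴ 0 =
      Matrix.fromBlocks X M' M'ᴴ X := hHeq
  rw [hHeq'] at hH hHv₀
  have hz' : lyap A N M' = z • M' := by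
    rw [hM', map_smul, hz, smul_comm]
  set A₂ := Matrix.fromBlocks (A - (z / 2) • 1) 0 0 (A - (star z / 2) • 1) with hA₂
  set N₂ := fun k => Matrix.fromBlocks (N k) 0 0 (N k) with hN₂
  set H := Matrix.fromBlocks X M' M'ᴴ X with hHdef
  have hLH : lyap A₂ N₂ H = Matrix.fromBlocks (lyap A N X - (z.re : ℂ) • X) 0 0
      (lyap A N X - (z.re : ℂ) • X) := by
    rw [lyap_fromBlocks, hz', sub_self, Matrix.conjTranspose_zero]
  have hS : (-(lyap A N X - (z.re : ℂ) • X)).PosSemidef := by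
    have : -(lyap A N X - (z.re : ℂ) • X) = -lyap A N X + (z.re : ℂ) • X := by abel
    rw [this]
    exact hL.add (hX.posSemidef.smul (by exact_mod_cast hre))
  have hLneg : (-lyap A₂ N₂ H).PosSemidef := by
    rw [hLH]
    refine Matrix.PosSemidef.of_dotProduct_mulVec_nonneg (by
      rw [Matrix.fromBlocks_neg, Matrix.IsHermitian, Matrix.fromBlocks_conjTranspose, hS.1.eq]
      simp) fun v => ?_
    obtain ⟨a, b, rfl⟩ : ∃ a b, v = Sum.elim a b := ⟨v ∘ Sum.inl, v ∘ Sum.inr, by simp⟩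
    have hs : star (Sum.elim a b) = Sum.elim (star a) (star b) := by
      ext (i | i) <;> rfl
    rw [Matrix.fromBlocks_neg, Matrix.fromBlocks_mulVec, hs, sumElim_dotProduct_sumElim]
    simp only [neg_zero, Matrix.zero_mulVec, add_zero, zero_add, Sum.elim_comp_inl,
      Sum.elim_comp_inr]
    exact add_nonneg (hS.dotProduct_mulVec_nonneg a) (hS.dotProduct_mulVec_nonneg b)
  have hker := fun (v : ι ⊕ ι → ℂ) (hv : H *ᵥ v = 0) =>
    kernel_invariant_of_lyap_nonpos hH hLneg hv
  -- a kernel vector is determined by its first half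
  have hfst : ∀ v : ι ⊕ ι → ℂ, H *ᵥ v = 0 → v ∘ Sum.inl = 0 → v = 0 := fun v hv h => by
    have h1 : (H *ᵥ v) ∘ Sum.inr = 0 := by rw [hv]; rfl
    rw [hHdef, Matrix.fromBlocks_mulVec, Sum.elim_comp_inr, h, Matrix.mulVec_zero, zero_add] at h1
    have h2 : v ∘ Sum.inr = 0 := by
      by_contra hne
      have := hX.dotProduct_mulVec_pos hne
      rw [h1, dotProduct_zero] at this
      exact lt_irrefl _ this
    ext (i | i)
    · exact congrFun h i
    · exact congrFun h2 i
  have hvan : ∀ v : ι ⊕ ι → ℂ, H *ᵥ v = 0 →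
      lyap A N X *ᵥ (v ∘ Sum.inl) = 0 ∧ (z.re : ℂ) • (X *ᵥ (v ∘ Sum.inl)) = 0 := fun v hv => by
    have h1 : (lyap A₂ N₂ H *ᵥ v) ∘ Sum.inl = 0 := by rw [(hker v hv).2.2]; rfl
    rw [hLH, Matrix.fromBlocks_mulVec, Sum.elim_comp_inl, Matrix.zero_mulVec, add_zero,
      Matrix.sub_mulVec, Matrix.smul_mulVec] at h1
    set a := v ∘ Sum.inl
    have h3 : star a ⬝ᵥ ((-lyap A N X) *ᵥ a) +
        star a ⬝ᵥ (((z.re : ℂ) • X) *ᵥ a) = 0 := by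
      rw [← dotProduct_add, Matrix.neg_mulVec, Matrix.smul_mulVec, neg_add_eq_sub, ← neg_sub, h1,
        neg_zero, dotProduct_zero]
    have h4 := hL.dotProduct_mulVec_nonneg a
    have h5 := (hX.posSemidef.smul (show (0 : ℂ) ≤ (z.re : ℂ) by
      exact_mod_cast hre)).dotProduct_mulVec_nonneg a
    have h6 := (hL.dotProduct_mulVec_zero_iff a).1 ((add_eq_zero_iff_of_nonneg h4 h5).1 h3).1
    rw [Matrix.neg_mulVec, neg_eq_zero] at h6
    refine ⟨h6, ?_⟩
    rw [h6, zero_sub, neg_eq_zero] at h1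
    exact h1
  refine ⟨?_, (LinearMap.ker H.mulVecLin).map (LinearMap.funLeft ℂ ℂ Sum.inl), ?_, ?_⟩
  · have hne : v₀ ∘ Sum.inl ≠ 0 := fun h => hv₀ (hfst v₀ hHv₀ h)
    have hp := hX.dotProduct_mulVec_pos hne
    rcases smul_eq_zero.1 (hvan v₀ hHv₀).2 with h | h
    · exact_mod_cast h
    · rw [h, dotProduct_zero] at hp
      exact absurd hp (lt_irrefl _)
  · intro hE
    have : v₀ ∘ Sum.inl ∈ (⊥ : Submodule ℂ (ι → ℂ)) := by
      rw [← hE]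
      exact ⟨v₀, hHv₀, rfl⟩
    exact hv₀ (hfst v₀ hHv₀ ((Submodule.mem_bot ℂ).1 this))
  · rintro _ ⟨v, hv, rfl⟩
    have hv' : H *ᵥ v = 0 := hv
    obtain ⟨hA, hN, -⟩ := hker v hv'
    refine ⟨?_, fun k => ⟨_, hN k, ?_⟩, (hvan v hv').1⟩
    · have h1 : (A₂ᴴ *ᵥ v) ∘ Sum.inl = Aᴴ *ᵥ (v ∘ Sum.inl) - star (z / 2) • (v ∘ Sum.inl) := by
        rw [hA₂, Matrix.fromBlocks_conjTranspose, Matrix.fromBlocks_mulVec, Sum.elim_comp_inl]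
        simp [Matrix.sub_mulVec, Matrix.smul_mulVec]
      have h2 : Aᴴ *ᵥ (LinearMap.funLeft ℂ ℂ Sum.inl v) =
          LinearMap.funLeft ℂ ℂ Sum.inl (A₂ᴴ *ᵥ v) +
            star (z / 2) • LinearMap.funLeft ℂ ℂ Sum.inl v :=
        (eq_add_of_sub_eq h1.symm)
      rw [h2]
      exact Submodule.add_mem _ ⟨_, hA, rfl⟩ (Submodule.smul_mem _ _ ⟨v, hv, rfl⟩)
    · change ((N₂ k)ᴴ *ᵥ v) ∘ Sum.inl = (N k)ᴴ *ᵥ (v ∘ Sum.inl)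
      rw [hN₂, Matrix.fromBlocks_conjTranspose, Matrix.fromBlocks_mulVec, Sum.elim_comp_inl]
      simp

end Doubling

/-! ### Complexification of real matrices -/

section Complexification

variable {ι κ l m : Type*} [Fintype ι] [Fintype κ]

lemma map_ofReal_mul (A : Matrix l ι ℝ) (B : Matrix ι m ℝ) :
    (A * B).map Complex.ofReal = A.map Complex.ofReal * B.map Complex.ofReal :=
  Matrix.map_mul (f := Complex.ofRealHom)

lemma conjTranspose_map_ofReal (A : Matrix l m ℝ) :
    (A.map Complex.ofReal)ᴴ = (Aᵀ).map Complex.ofReal := by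
  ext i j
  simp

lemma lyap_map_ofReal (A : Matrix ι ι ℝ) (N : κ → Matrix ι ι ℝ) (X : Matrix ι ι ℝ) :
    (lyap A N X).map Complex.ofReal =
      lyap (A.map Complex.ofReal) (fun k => (N k).map Complex.ofReal) (X.map Complex.ofReal) := by
  have hsum : (∑ k, N k * X * (N k)ᵀ).map Complex.ofReal =
      ∑ k, (N k * X * (N k)ᵀ).map Complex.ofReal := by
    ext i j
    simp [Matrix.sum_apply]
  simp only [lyap_apply, Matrix.conjTranspose_eq_transpose_of_trivial, conjTranspose_map_ofReal,
    ← map_ofReal_mul, ← hsum]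
  ext i j
  simp

lemma posSemidef_map_ofReal {X : Matrix ι ι ℝ} (hX : X.PosSemidef) :
    (X.map Complex.ofReal).PosSemidef := by
  classical
  obtain ⟨B, hB⟩ : ∃ B : Matrix ι ι ℝ, X = Bᵀ * B := by
    open scoped MatrixOrder in
    obtain ⟨B, hB⟩ := CStarAlgebra.nonneg_iff_eq_star_mul_self.mp hX.nonneg
    exact ⟨B, by rw [hB, Matrix.star_eq_conjTranspose,
      Matrix.conjTranspose_eq_transpose_of_trivial]⟩
  rw [hB, map_ofReal_mul, ← conjTranspose_map_ofReal]
  exact Matrix.posSemidef_conjTranspose_mul_self _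

lemma posDef_map_ofReal {X : Matrix ι ι ℝ} (hX : X.PosDef) :
    (X.map Complex.ofReal).PosDef := by
  classical
  rw [(posSemidef_map_ofReal hX.posSemidef).posDef_iff_isUnit]
  exact hX.isUnit.map Complex.ofRealHom.mapMatrix

end Complexification

/-! ### The Kronecker matrix and the Lyapunov operator -/

section Kronecker

lemma lyapunovOp_eq_lyap {n m : ℕ} (A : Matrix (Fin n) (Fin n) ℝ)
    (N : Fin m → Matrix (Fin n) (Fin n) ℝ) (γ : ℝ) (X : Matrix (Fin n) (Fin n) ℝ) :
    lyapunovOp A N γ X = lyap A (fun k => γ⁻¹ • N k) X := by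
  simp only [lyapunovOp, lyap_apply, Matrix.conjTranspose_eq_transpose_of_trivial,
    Matrix.transpose_smul, Matrix.smul_mul, Matrix.mul_smul, smul_smul, Finset.smul_sum]
  congr! 3
  ring

/-- Points of the complex spectrum of the Kronecker matrix are eigenvalues of the complexified
Lyapunov operator, by vectorization. -/
lemma exists_eigenvector_of_mem_complexSpectrum {n m : ℕ} {A : Matrix (Fin n) (Fin n) ℝ}
    {N : Fin m → Matrix (Fin n) (Fin n) ℝ} {γ : ℝ} {z : ℂ}
    (hz : z ∈ complexSpectrum (kroneckerOp A N γ)) :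
    ∃ M : Matrix (Fin n) (Fin n) ℂ, M ≠ 0 ∧
      lyap (A.map Complex.ofReal) (fun k => (γ⁻¹ • N k).map Complex.ofReal) M = z • M := by
  rw [complexSpectrum, spectrum.mem_iff, Matrix.isUnit_iff_isUnit_det, isUnit_iff_ne_zero,
    not_not, ← Matrix.exists_mulVec_eq_zero_iff] at hz
  obtain ⟨v, hv0, hv⟩ := hz
  obtain ⟨M, rfl⟩ := Matrix.vec_bijective.2 v
  refine ⟨M, fun h => hv0 (by rw [h, Matrix.vec_zero]), ?_⟩
  rw [Matrix.sub_mulVec, sub_eq_zero, Algebra.algebraMap_eq_smul_one, Matrix.smul_mulVec,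
    Matrix.one_mulVec, ← Matrix.vec_smul] at hv
  rw [← Matrix.vec_inj, hv]
  have hK : (kroneckerOp A N γ).map (fun x : ℝ => (x : ℂ)) =
      1 ⊗ₖ A.map Complex.ofReal + A.map Complex.ofReal ⊗ₖ 1 +
        ∑ k, (γ⁻¹ • N k).map Complex.ofReal ⊗ₖ (γ⁻¹ • N k).map Complex.ofReal := by
    ext ⟨i, j⟩ ⟨i', j'⟩
    simp only [kroneckerOp, Matrix.map_apply, Matrix.add_apply, Matrix.smul_apply,
      Matrix.kronecker_apply, Matrix.sum_apply, Matrix.one_apply, smul_eq_mul, Finset.mul_sum]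
    push_cast
    congr 1
    · congr 1
      · split_ifs <;> simp
      · split_ifs <;> simp
    · refine Finset.sum_congr rfl fun k _ => ?_
      ring
  rw [hK, Matrix.add_mulVec, Matrix.add_mulVec, Matrix.sum_mulVec]
  simp only [Matrix.kronecker_mulVec_vec, ← Matrix.vec_sum, ← Matrix.vec_add, lyap_apply,
    conjTranspose_map_ofReal, Matrix.transpose_one, Matrix.mul_one, Matrix.one_mul,
    Matrix.transpose_map]

end Kronecker

/-! ### The reachable subspace and the reduced inequality -/

section Reachability

variable {ι κ l : Type*} [Fintype ι] [Fintype κ] [Fintype l]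

lemma star_dotProduct_ofReal_mulVec (B : Matrix ι l ℝ) (v : ι → ℂ) (w : l → ℝ) :
    star v ⬝ᵥ (Complex.ofReal ∘ (B *ᵥ w)) =
      star ((B.map Complex.ofReal)ᴴ *ᵥ v) ⬝ᵥ (Complex.ofReal ∘ w) := by
  have : Complex.ofReal ∘ (B *ᵥ w) = B.map Complex.ofReal *ᵥ (Complex.ofReal ∘ w) := by
    ext i
    simp [Matrix.mulVec, dotProduct]
  rw [this, Matrix.dotProduct_mulVec, Matrix.star_mulVec, Matrix.conjTranspose_conjTranspose]

/-- If the Lyapunov inequality holds with some `X > 0`, an eigenvalue of the Lyapunov operator in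
the closed right half-plane is purely imaginary, and then the columns of `X₀` lie in a proper
subspace that is invariant under `A` and all `Nₖ`. -/
lemma exists_invariant_of_eigenvalue {A : Matrix ι ι ℝ} {N : κ → Matrix ι ι ℝ}
    {X : Matrix ι ι ℝ} {X₀ : Matrix ι l ℝ} (hX : X.PosDef)
    (hL : (-(X₀ * X₀ᵀ) - lyap A N X).PosSemidef) {z : ℂ} {M : Matrix ι ι ℂ} (hM : M ≠ 0)
    (hz : lyap (A.map Complex.ofReal) (fun k => (N k).map Complex.ofReal) M = z • M)
    (hre : 0 ≤ z.re) :
    z.re = 0 ∧ ∃ G : Submodule ℝ (ι → ℝ), G ≠ ⊤ ∧ (∀ w ∈ G, A *ᵥ w ∈ G) ∧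
      (∀ k, ∀ w ∈ G, N k *ᵥ w ∈ G) ∧ ∀ x, X₀ *ᵥ x ∈ G := by
  classical
  have hXX : (X₀ * X₀ᵀ).PosSemidef := by
    simpa using Matrix.posSemidef_self_mul_conjTranspose X₀
  have hL' : (-lyap A N X).PosSemidef := by
    have h := hL.add hXX
    rwa [show -(X₀ * X₀ᵀ) - lyap A N X + X₀ * X₀ᵀ = -lyap A N X by abel] at h
  have hLc := posSemidef_map_ofReal hL'
  rw [show (-lyap A N X).map Complex.ofReal = -(lyap A N X).map Complex.ofReal by ext; simp,
    lyap_map_ofReal] at hLc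
  obtain ⟨h0, E, hE, hinv⟩ := eigenvalue_obstruction (posDef_map_ofReal hX) hLc hM hz hre
  have hX₀ : ∀ v ∈ E, (X₀.map Complex.ofReal)ᴴ *ᵥ v = 0 := fun v hv => by
    have h1 := (posSemidef_map_ofReal hL).dotProduct_mulVec_nonneg v
    rw [show (-(X₀ * X₀ᵀ) - lyap A N X).map Complex.ofReal =
      -(X₀ * X₀ᵀ).map Complex.ofReal - (lyap A N X).map Complex.ofReal by ext; simp,
      lyap_map_ofReal, Matrix.sub_mulVec, (hinv v hv).2.2, sub_zero, Matrix.neg_mulVec,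
      dotProduct_neg, map_ofReal_mul, ← conjTranspose_map_ofReal, ← Matrix.mulVec_mulVec,
      Matrix.dotProduct_mulVec] at h1
    have h2 : star v ᵥ* X₀.map Complex.ofReal = star ((X₀.map Complex.ofReal)ᴴ *ᵥ v) := by
      rw [Matrix.star_mulVec, Matrix.conjTranspose_conjTranspose]
    rw [h2] at h1
    by_contra hne
    have := Matrix.dotProduct_star_self_pos_iff.2 hne
    exact lt_irrefl _ (this.trans_le (neg_nonneg.1 h1))
  -- the annihilator of `E` among the real vectors
  refine ⟨h0, ⟨⟨⟨{w | ∀ v ∈ E, star v ⬝ᵥ (Complex.ofReal ∘ w) = 0}, ?_⟩, ?_⟩, ?_⟩, ?_, ?_, ?_, ?_⟩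
  · intro a b ha hb v hv
    rw [show Complex.ofReal ∘ (a + b) = Complex.ofReal ∘ a + Complex.ofReal ∘ b by ext; simp,
      dotProduct_add, ha v hv, hb v hv, add_zero]
  · intro v hv
    rw [show Complex.ofReal ∘ (0 : ι → ℝ) = 0 by ext; simp, dotProduct_zero]
  · intro c a ha v hv
    rw [show Complex.ofReal ∘ (c • a) = (c : ℂ) • (Complex.ofReal ∘ a) by ext; simp,
      dotProduct_smul, ha v hv, smul_zero]
  · intro htop
    obtain ⟨v, hv, hv0⟩ := (Submodule.ne_bot_iff E).1 hE
    refine hv0 (funext fun i => ?_)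
    have h : Pi.single i (1 : ℝ) ∈ (⊤ : Submodule ℝ (ι → ℝ)) := Submodule.mem_top
    rw [← htop] at h
    have h1 := h v hv
    rw [show Complex.ofReal ∘ (Pi.single i (1 : ℝ)) = Pi.single i (1 : ℂ) by
      ext j; by_cases h : j = i <;> [subst h; skip] <;> simp [*], dotProduct_single_one] at h1
    simpa using h1
  · intro w hw v hv
    rw [star_dotProduct_ofReal_mulVec]
    exact hw _ (hinv v hv).1
  · intro k w hw v hv
    rw [star_dotProduct_ofReal_mulVec]
    exact hw _ ((hinv v hv).2.1 k)
  · intro x v hv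
    rw [star_dotProduct_ofReal_mulVec, hX₀ v hv, star_zero, zero_dotProduct]

lemma eq_mul_of_range_fixed {ρ : Type*} [Fintype ρ] {W : Submodule ℝ (ι → ℝ)} {V : Matrix ι ρ ℝ}
    (hV : ∀ w ∈ W, V *ᵥ (Vᵀ *ᵥ w) = w) (B : Matrix ι l ℝ) (hB : ∀ x, B *ᵥ x ∈ W) :
    B = V * (Vᵀ * B) := by
  classical
  refine Matrix.ext_of_mulVec_single fun i => ?_
  rw [← Matrix.mulVec_mulVec, ← Matrix.mulVec_mulVec, hV _ (hB _)]

/-- Orthonormal coordinates `V` on the smallest subspace that contains the columns of `X₀` and is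
invariant under `A` and all `Nₖ`. In these coordinates there is no proper invariant subspace that
contains the columns of the initial matrix. -/
lemma exists_reachable_coordinates {κ q : Type*} {n : ℕ} [Fintype q] (A : Matrix (Fin n) (Fin n) ℝ)
    (N : κ → Matrix (Fin n) (Fin n) ℝ) (X₀ : Matrix (Fin n) q ℝ) :
    ∃ (r : ℕ) (V : Matrix (Fin n) (Fin r) ℝ), r ≤ n ∧ Vᵀ * V = 1 ∧
      A * V = V * (Vᵀ * A * V) ∧ (∀ k, N k * V = V * (Vᵀ * N k * V)) ∧ X₀ = V * (Vᵀ * X₀) ∧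
      ∀ G : Submodule ℝ (Fin r → ℝ), (∀ w ∈ G, (Vᵀ * A * V) *ᵥ w ∈ G) →
        (∀ k, ∀ w ∈ G, (Vᵀ * N k * V) *ᵥ w ∈ G) → (∀ x, (Vᵀ * X₀) *ᵥ x ∈ G) → G = ⊤ := by
  classical
  set S : Set (Submodule ℝ (Fin n → ℝ)) := {p | (∀ w ∈ p, A *ᵥ w ∈ p) ∧
    (∀ k, ∀ w ∈ p, N k *ᵥ w ∈ p) ∧ ∀ x, X₀ *ᵥ x ∈ p} with hS
  set W := sInf S with hW
  have hWA : ∀ w ∈ W, A *ᵥ w ∈ W := fun w hw => by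
    rw [hW, Submodule.mem_sInf] at hw ⊢
    exact fun p hp => hp.1 w (hw p hp)
  have hWN : ∀ k, ∀ w ∈ W, N k *ᵥ w ∈ W := fun k w hw => by
    rw [hW, Submodule.mem_sInf] at hw ⊢
    exact fun p hp => hp.2.1 k w (hw p hp)
  have hWX : ∀ x, X₀ *ᵥ x ∈ W := fun x => by
    rw [hW, Submodule.mem_sInf]
    exact fun p hp => hp.2.2 x
  set e := WithLp.linearEquiv 2 ℝ (Fin n → ℝ) with he
  set W' : Submodule ℝ (EuclideanSpace ℝ (Fin n)) := W.comap e.toLinearMap with hW'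
  set b := stdOrthonormalBasis ℝ W' with hb
  set V : Matrix (Fin n) (Fin (Module.finrank ℝ W')) ℝ :=
    Matrix.of fun i j => (b j : EuclideanSpace ℝ (Fin n)) i with hV
  have hVmul : ∀ g, V *ᵥ g = e ((∑ j, g j • b j : W') : EuclideanSpace ℝ (Fin n)) := fun g => by
    ext i
    simp [hV, he, Matrix.mulVec, dotProduct, mul_comm]
  have hVW : ∀ g, V *ᵥ g ∈ W := fun g => by
    rw [hVmul]
    exact (∑ j, g j • b j : W').2
  have hVV : Vᵀ * V = 1 := by
    ext i j
    have := orthonormal_iff_ite.1 b.orthonormal j i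
    rw [Submodule.coe_inner, PiLp.inner_apply] at this
    simp only [RCLike.inner_apply, conj_trivial] at this
    rw [Matrix.mul_apply, Matrix.one_apply]
    simp only [hV, Matrix.transpose_apply, Matrix.of_apply]
    rw [this]
    simp [eq_comm]
  have hproj : ∀ w ∈ W, V *ᵥ (Vᵀ *ᵥ w) = w := fun w hw => by
    obtain ⟨g, rfl⟩ : ∃ g, w = V *ᵥ g := by
      refine ⟨b.repr ⟨e.symm w, by simpa [hW'] using hw⟩, ?_⟩
      rw [hVmul, b.sum_repr]
      simp
    rw [Matrix.mulVec_mulVec g Vᵀ V, hVV, Matrix.one_mulVec]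
  have h1 : A * V = V * (Vᵀ * A * V) := by
    rw [Matrix.mul_assoc Vᵀ]
    exact eq_mul_of_range_fixed hproj _ fun x => by
      rw [← Matrix.mulVec_mulVec]
      exact hWA _ (hVW x)
  have h2 : ∀ k, N k * V = V * (Vᵀ * N k * V) := fun k => by
    rw [Matrix.mul_assoc Vᵀ]
    exact eq_mul_of_range_fixed hproj _ fun x => by
      rw [← Matrix.mulVec_mulVec]
      exact hWN k _ (hVW x)
  have h3 : X₀ = V * (Vᵀ * X₀) := eq_mul_of_range_fixed hproj _ hWX
  refine ⟨_, V, ?_, hVV, h1, h2, h3, fun G hGA hGN hGX => ?_⟩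
  · simpa using Submodule.finrank_le W'
  · have hle : W ≤ G.map V.mulVecLin := by
      refine sInf_le ⟨?_, ?_, fun x => ⟨_, hGX x, ?_⟩⟩
      · rintro _ ⟨g, hg, rfl⟩
        refine ⟨_, hGA g hg, ?_⟩
        simp only [Matrix.mulVecLin_apply]
        rw [Matrix.mulVec_mulVec, Matrix.mulVec_mulVec, h1]
      · rintro k _ ⟨g, hg, rfl⟩
        refine ⟨_, hGN k g hg, ?_⟩
        simp only [Matrix.mulVecLin_apply]
        rw [Matrix.mulVec_mulVec, Matrix.mulVec_mulVec, h2]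
      · rw [Matrix.mulVecLin_apply, Matrix.mulVec_mulVec, ← h3]
    refine eq_top_iff.2 fun g _ => ?_
    obtain ⟨g', hg', hgg⟩ := hle (hVW g)
    have := congrArg (fun w => Vᵀ *ᵥ w) hgg
    simp only [Matrix.mulVecLin_apply, Matrix.mulVec_mulVec, hVV, Matrix.one_mulVec] at this
    rwa [← this]

/-- The Lyapunov inequality passes to an invariant subspace with orthonormal coordinates `V`, with
`X` replaced by `(Vᵀ X⁻¹ V)⁻¹`. -/
lemma exists_reduced_lyapunov_inequality [DecidableEq ι] {ρ : Type*} [Fintype ρ] [DecidableEq ρ]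
    {A : Matrix ι ι ℝ} {N : κ → Matrix ι ι ℝ} {X : Matrix ι ι ℝ} {X₀ : Matrix ι l ℝ}
    {V : Matrix ι ρ ℝ} {A' : Matrix ρ ρ ℝ} {N' : κ → Matrix ρ ρ ℝ} {X₀' : Matrix ρ l ℝ}
    (hX : X.PosDef) (hL : (-(X₀ * X₀ᵀ) - lyap A N X).PosSemidef) (hV : Vᵀ * V = 1)
    (hA : A * V = V * A') (hN : ∀ k, N k * V = V * N' k) (hX₀ : X₀ = V * X₀') :
    ∃ X' : Matrix ρ ρ ℝ, X'.PosDef ∧ (-(X₀' * X₀'ᵀ) - lyap A' N' X').PosSemidef := by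
  have hXi := hX.inv
  have hXdet : IsUnit X.det := (Matrix.isUnit_iff_isUnit_det X).1 hX.isUnit
  have hinj : Function.Injective V.mulVec := fun a b h => by
    have := congrArg (fun w => Vᵀ *ᵥ w) h
    simpa [Matrix.mulVec_mulVec, hV] using this
  have hP : (Vᵀ * X⁻¹ * V).PosDef := by
    have := hXi.conjTranspose_mul_mul_same hinj
    rwa [Matrix.conjTranspose_eq_transpose_of_trivial] at this
  have hPdet : IsUnit (Vᵀ * X⁻¹ * V).det := (Matrix.isUnit_iff_isUnit_det _).1 hP.isUnit
  set X' := (Vᵀ * X⁻¹ * V)⁻¹ with hX'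
  have hX'pos : X'.PosDef := hP.inv
  have hXt : Xᵀ = X := by simpa [Matrix.IsHermitian] using hX.1
  have hX't : X'ᵀ = X' := by simpa [Matrix.IsHermitian] using hX'pos.1
  -- `T` is the left inverse of `V` whose kernel is the `X⁻¹`-orthogonal complement of its range
  set T := X' * Vᵀ * X⁻¹ with hT
  have hTV : T * V = 1 := by
    rw [hT, Matrix.mul_assoc, Matrix.mul_assoc, ← Matrix.mul_assoc Vᵀ, hX']
    exact Matrix.nonsing_inv_mul _ hPdet
  have hTX : T * X = X' * Vᵀ := by
    rw [hT, Matrix.mul_assoc, Matrix.nonsing_inv_mul _ hXdet, Matrix.mul_one]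
  have hXT : X * Tᵀ = V * X' := by
    have := congrArg Matrix.transpose hTX
    rwa [Matrix.transpose_mul T X, Matrix.transpose_mul X' Vᵀ, hXt, hX't,
      Matrix.transpose_transpose] at this
  have hVT : Vᵀ * Tᵀ = 1 := by
    rw [← Matrix.transpose_mul, hTV, Matrix.transpose_one]
  have hY : (X - V * X' * Vᵀ).PosSemidef := by
    have h := hX.posSemidef.mul_mul_conjTranspose_same (1 - V * T)
    have h1 : (1 - V * T) * X * (1 - V * T)ᴴ = X - V * X' * Vᵀ := by
      rw [Matrix.conjTranspose_eq_transpose_of_trivial, Matrix.transpose_sub, Matrix.transpose_one,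
        Matrix.transpose_mul, Matrix.sub_mul, Matrix.one_mul, Matrix.mul_sub, Matrix.mul_one,
        Matrix.mul_assoc V, hTX, Matrix.sub_mul, ← Matrix.mul_assoc X, hXT,
        Matrix.mul_assoc V (X' * Vᵀ), Matrix.mul_assoc X', ← Matrix.mul_assoc Vᵀ, hVT,
        Matrix.one_mul, ← Matrix.mul_assoc V X']
      abel
    rwa [h1] at h
  refine ⟨X', hX'pos, ?_⟩
  have hmain : -(X₀' * X₀'ᵀ) - lyap A' N' X' = T * (-(X₀ * X₀ᵀ) - lyap A N X) * Tᴴ +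
      ∑ k, (T * N k) * (X - V * X' * Vᵀ) * (T * N k)ᴴ := by
    have hTA : T * A * V = A' := by rw [Matrix.mul_assoc, hA, ← Matrix.mul_assoc, hTV,
      Matrix.one_mul]
    have hTN : ∀ k, T * N k * V = N' k := fun k => by
      rw [Matrix.mul_assoc, hN, ← Matrix.mul_assoc, hTV, Matrix.one_mul]
    have hTX₀ : T * X₀ = X₀' := by rw [hX₀, ← Matrix.mul_assoc, hTV, Matrix.one_mul]
    have e1 : T * (X₀ * X₀ᵀ) * Tᵀ = X₀' * X₀'ᵀ := by
      rw [← Matrix.mul_assoc, hTX₀, Matrix.mul_assoc, ← Matrix.transpose_mul, hTX₀]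
    have e2 : T * (A * X) * Tᵀ = A' * X' := by
      rw [← Matrix.mul_assoc, Matrix.mul_assoc, hXT, ← Matrix.mul_assoc, hTA]
    have e3 : T * (X * Aᵀ) * Tᵀ = X' * A'ᵀ := by
      have := congrArg Matrix.transpose e2
      simpa only [Matrix.transpose_mul, Matrix.transpose_transpose, hXt, hX't,
        Matrix.mul_assoc] using this
    have e4 : ∀ k, T * (N k * X * (N k)ᵀ) * Tᵀ =
        N' k * X' * (N' k)ᵀ + T * N k * (X - V * X' * Vᵀ) * (T * N k)ᵀ := fun k => by
      rw [← hTN k]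
      simp only [Matrix.transpose_mul, Matrix.mul_sub, Matrix.sub_mul, Matrix.mul_assoc]
      abel
    simp only [lyap_apply, Matrix.conjTranspose_eq_transpose_of_trivial]
    simp only [Matrix.mul_sub, Matrix.sub_mul, Matrix.mul_add, Matrix.add_mul, Matrix.mul_neg,
      Matrix.neg_mul, e1, e2, e3, Matrix.mul_sum, Matrix.sum_mul] at e4 ⊢
    simp only [e4, Finset.sum_add_distrib, Finset.sum_sub_distrib]
    abel
  rw [hmain]
  exact (hL.mul_mul_conjTranspose_same T).add (Matrix.posSemidef_sum _ fun k _ =>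
    hY.mul_mul_conjTranspose_same (T * N k))

end Reachability

/-! ### Comparison principle and exponential decay -/

section Decay

variable {ι κ : Type*} [Fintype ι] [Fintype κ] [DecidableEq ι]

omit [DecidableEq ι] in
/-- Positive definiteness is an open condition along Hermitian directions. -/
lemma exists_posDef_add_smul {P Q : Matrix ι ι ℝ} (hP : P.PosDef) (hQ : Q.IsHermitian) :
    ∃ ε : ℝ, 0 < ε ∧ (P + ε • Q).PosDef ∧ (P - ε • Q).PosDef := by
  obtain ⟨C, hC, h⟩ := exists_abs_form_le hP Q
  simp only [RCLike.re_to_real] at h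
  have key : ∀ s : ℝ, |s| = 1 / (2 * C) → (P + s • Q).PosDef := fun s hs => by
    refine Matrix.PosDef.of_dotProduct_mulVec_pos (hP.1.add (hQ.smul (IsSelfAdjoint.all _)))
      fun v hv => ?_
    have h1 := hP.dotProduct_mulVec_pos hv
    have h2 : |s * (star v ⬝ᵥ (Q *ᵥ v))| ≤ (star v ⬝ᵥ (P *ᵥ v)) / 2 := by
      rw [abs_mul, hs]
      refine (mul_le_mul_of_nonneg_left (h v) (by positivity)).trans_eq ?_
      field_simp
    rw [Matrix.add_mulVec, dotProduct_add, Matrix.smul_mulVec, dotProduct_smul, smul_eq_mul]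
    linarith [neg_abs_le (s * (star v ⬝ᵥ (Q *ᵥ v)))]
  have hε : 0 < 1 / (2 * C) := by positivity
  refine ⟨1 / (2 * C), hε, key _ (abs_of_pos hε), ?_⟩
  have h1 := key (-(1 / (2 * C))) (by rw [abs_neg, abs_of_pos hε])
  rwa [neg_smul, ← sub_eq_add_neg] at h1

/-- If the Lyapunov operator is injective, a solution `X > 0` of the weak Lyapunov inequality can be
perturbed to a solution of a strict one: move in the direction `Q` with `lyap A N Q = -1`. -/
lemma exists_strict_lyapunov {A : Matrix ι ι ℝ} {N : κ → Matrix ι ι ℝ} {X : Matrix ι ι ℝ}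
    (hX : X.PosDef) (hL : (-lyap A N X).PosSemidef) (hinj : Function.Injective (lyap A N)) :
    ∃ (Y : Matrix ι ι ℝ) (c : ℝ), 0 < c ∧ Y.PosDef ∧ (-lyap A N Y - c • Y).PosDef := by
  obtain ⟨Q, hQ⟩ := (LinearMap.injective_iff_surjective.1 hinj) (-1)
  have hQh : Q.IsHermitian := hinj (by
    rw [← lyap_conjTranspose, hQ, Matrix.conjTranspose_neg, Matrix.conjTranspose_one])
  obtain ⟨s, hs, hY, -⟩ := exists_posDef_add_smul hX hQh
  obtain ⟨ε, hε, -, h1⟩ := exists_posDef_add_smul (Matrix.PosDef.one (n := ι) (R := ℝ)) hY.1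
  refine ⟨X + s • Q, s * ε, mul_pos hs hε, hY, ?_⟩
  have h2 : -lyap A N (X + s • Q) - (s * ε) • (X + s • Q) =
      -lyap A N X + s • (1 - ε • (X + s • Q)) := by
    rw [map_add, map_smul, hQ, smul_sub, smul_smul, smul_neg]
    abel
  rw [h2]
  exact (h1.smul hs).posSemidef_add hL

/-- Comparison principle: a solution of the strict differential Lyapunov inequality that starts
positive definite stays positive definite. At the first time where the quadratic form vanishes in
some direction `v`, its derivative along `v` would have to be both nonpositive and positive. -/
lemma posDef_of_strict_differential_inequality {A : Matrix ι ι ℝ} {N : κ → Matrix ι ι ℝ}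
    {D D' : ℝ → Matrix ι ι ℝ} (hsymm : ∀ t, 0 ≤ t → (D t).IsHermitian) (h0 : (D 0).PosDef)
    (hD : ∀ t, 0 ≤ t → HasDerivWithinAt D (D' t) (Set.Ici 0) t)
    (hineq : ∀ t, 0 ≤ t → (D' t - lyap A N (D t)).PosDef) {t : ℝ} (ht : 0 ≤ t) :
    (D t).PosDef := by
  by_contra hnot
  have hcont : ContinuousOn D (Set.Ici 0) := fun s hs => (hD s hs).continuousWithinAt
  set K₀ : Set (ℝ × (ι → ℝ)) := Set.Icc 0 t ×ˢ Metric.sphere 0 1 with hK₀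
  set f : ℝ × (ι → ℝ) → ℝ := fun p => p.2 ⬝ᵥ (D p.1 *ᵥ p.2) with hf
  have hfc : ContinuousOn f K₀ := by
    have h1 : ContinuousOn (fun p : ℝ × (ι → ℝ) => D p.1) K₀ :=
      hcont.comp continuousOn_fst fun p hp => hp.1.1
    have h2 : Continuous fun q : Matrix ι ι ℝ × (ι → ℝ) => q.2 ⬝ᵥ (q.1 *ᵥ q.2) :=
      Continuous.dotProduct continuous_snd (Continuous.matrix_mulVec continuous_fst continuous_snd)
    exact h2.comp_continuousOn (h1.prodMk continuousOn_snd)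
  have hK₀c : IsCompact K₀ := isCompact_Icc.prod (isCompact_sphere _ _)
  have hKc : IsCompact (K₀ ∩ f ⁻¹' Set.Iic 0) :=
    hK₀c.of_isClosed_subset (hfc.preimage_isClosed_of_isClosed hK₀c.isClosed isClosed_Iic)
      Set.inter_subset_left
  have hscale : ∀ w : ι → ℝ, w ≠ 0 → ∃ w' ∈ Metric.sphere (0 : ι → ℝ) 1,
      ∃ a : ℝ, 0 < a ∧ ∀ M : Matrix ι ι ℝ, w' ⬝ᵥ (M *ᵥ w') = a * (w ⬝ᵥ (M *ᵥ w)) :=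
    fun w hw => by
      have hn : 0 < ‖w‖ := norm_pos_iff.2 hw
      refine ⟨‖w‖⁻¹ • w, ?_, ‖w‖⁻¹ * ‖w‖⁻¹, by positivity, fun M => ?_⟩
      · rw [mem_sphere_zero_iff_norm, norm_smul, norm_inv, norm_norm, inv_mul_cancel₀ hn.ne']
      · rw [Matrix.mulVec_smul, smul_dotProduct, dotProduct_smul, smul_smul, smul_eq_mul]
  have hne : (K₀ ∩ f ⁻¹' Set.Iic 0).Nonempty := by
    obtain ⟨w, hw, hw'⟩ : ∃ w : ι → ℝ, w ≠ 0 ∧ w ⬝ᵥ (D t *ᵥ w) ≤ 0 := by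
      by_contra! h
      exact hnot (Matrix.PosDef.of_dotProduct_mulVec_pos (hsymm t ht) fun w hw => by
        rw [star_trivial]
        exact h w hw)
    obtain ⟨w', hw1, a, ha, hM⟩ := hscale w hw
    refine ⟨(t, w'), ⟨⟨ht, le_rfl⟩, hw1⟩, ?_⟩
    change w' ⬝ᵥ (D t *ᵥ w') ≤ 0
    rw [hM]
    exact mul_nonpos_of_nonneg_of_nonpos ha.le hw'
  obtain ⟨⟨τ, v⟩, ⟨⟨hτ, hv⟩, hle⟩, hmin⟩ := hKc.exists_isMinOn hne continuousOn_fst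
  replace hle : v ⬝ᵥ (D τ *ᵥ v) ≤ 0 := hle
  have hv0 : v ≠ 0 := by
    rintro rfl
    simp at hv
  have hbefore : ∀ s, 0 ≤ s → s < τ → ∀ w : ι → ℝ, w ≠ 0 → 0 < w ⬝ᵥ (D s *ᵥ w) := by
    intro s hs hsτ w hw
    by_contra hcon
    obtain ⟨w', hw1, a, ha, hM⟩ := hscale w hw
    have hmem : ((s, w') : ℝ × (ι → ℝ)) ∈ K₀ ∩ f ⁻¹' Set.Iic 0 := by
      refine ⟨⟨⟨hs, hsτ.le.trans hτ.2⟩, hw1⟩, ?_⟩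
      change w' ⬝ᵥ (D s *ᵥ w') ≤ 0
      rw [hM]
      exact mul_nonpos_of_nonneg_of_nonpos ha.le (not_lt.1 hcon)
    exact absurd (hmin hmem) (not_le.2 hsτ)
  have hτ0 : 0 < τ := by
    rcases hτ.1.eq_or_lt with h | h
    · have h1 := h0.dotProduct_mulVec_pos hv0
      obtain rfl : (0 : ℝ) = τ := h
      rw [star_trivial] at h1
      exact absurd hle (not_le.2 h1)
    · exact h
  have hne' := right_nhdsWithin_Ico_neBot hτ0
  -- the quadratic form along a fixed direction, as a function of time
  have hform : ∀ w : ι → ℝ, HasDerivWithinAt (fun s => w ⬝ᵥ (D s *ᵥ w)) (w ⬝ᵥ (D' τ *ᵥ w))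
      (Set.Ico 0 τ) τ := fun w => by
    let φ : Matrix ι ι ℝ →ₗ[ℝ] ℝ :=
      { toFun := fun M => w ⬝ᵥ (M *ᵥ w)
        map_add' := fun M M' => by rw [Matrix.add_mulVec, dotProduct_add]
        map_smul' := fun c M => by
          rw [Matrix.smul_mulVec, dotProduct_smul, RingHom.id_apply] }
    exact (φ.toContinuousLinearMap.hasFDerivAt.comp_hasDerivWithinAt τ
      ((hD τ hτ.1).mono Set.Ico_subset_Ici_self))
  have hpsd : (D τ).PosSemidef := by
    refine Matrix.PosSemidef.of_dotProduct_mulVec_nonneg (hsymm τ hτ.1) fun w => ?_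
    rw [star_trivial]
    refine ge_of_tendsto (hform w).continuousWithinAt
      (eventually_nhdsWithin_of_forall fun s hs => ?_)
    rcases eq_or_ne w 0 with rfl | hw
    · simp
    · exact (hbefore s hs.1 hs.2 w hw).le
  have hzero : v ⬝ᵥ (D τ *ᵥ v) = 0 := le_antisymm hle (by
    simpa using hpsd.dotProduct_mulVec_nonneg v)
  have hker : D τ *ᵥ v = 0 := (hpsd.dotProduct_mulVec_zero_iff v).1 (by rwa [star_trivial])
  have hpos : 0 < v ⬝ᵥ (D' τ *ᵥ v) := by
    have h1 := (hineq τ hτ.1).dotProduct_mulVec_pos hv0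
    rw [Matrix.sub_mulVec, dotProduct_sub, star_dotProduct_lyap_mulVec hpsd.1 hker, sub_pos] at h1
    rw [star_trivial] at h1
    exact (Finset.sum_nonneg fun k _ => hpsd.dotProduct_mulVec_nonneg _).trans_lt h1
  have hslope := (hasDerivWithinAt_iff_tendsto_slope' (Set.right_notMem_Ico)).1 (hform v)
  refine absurd (le_of_tendsto hslope (eventually_nhdsWithin_of_forall fun s hs => ?_))
    (not_le.2 hpos)
  rw [slope_def_field, hzero, sub_zero]
  exact div_nonpos_of_nonneg_of_nonpos (hbefore s hs.1 hs.2 v hv0).le (sub_nonpos.2 hs.2.le)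

/-- A symmetric matrix whose quadratic form is dominated by that of `Y` is bounded in norm. -/
lemma exists_norm_le_of_abs_form_le (Y : Matrix ι ι ℝ) :
    ∃ K : ℝ, ∀ (Z : Matrix ι ι ℝ) (b : ℝ), Z.IsHermitian →
      (∀ w : ι → ℝ, |w ⬝ᵥ (Z *ᵥ w)| ≤ b * (w ⬝ᵥ (Y *ᵥ w))) → ‖Z‖ ≤ K * b := by
  refine ⟨∑ i, ∑ j, (Y i i + Y j j) / 2 * ‖Matrix.single i j (1 : ℝ)‖, fun Z b hZ h => ?_⟩
  have hentry : ∀ i j, |Z i j| ≤ (Y i i + Y j j) / 2 * b := fun i j => by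
    have hexp : ∀ (M : Matrix ι ι ℝ) (s : ℝ), (Pi.single i 1 + s • Pi.single j 1 : ι → ℝ) ⬝ᵥ
        (M *ᵥ (Pi.single i 1 + s • Pi.single j 1)) =
          M i i + s * M i j + s * M j i + s * s * M j j := fun M s => by
      simp only [Matrix.mulVec_add, Matrix.mulVec_smul, dotProduct_add, add_dotProduct,
        dotProduct_smul, smul_dotProduct, Matrix.mulVec_single_one, single_one_dotProduct,
        Matrix.col_apply, smul_eq_mul]
      ring
    have hs : Z j i = Z i j := by simpa using hZ.apply i j
    have h1 := h (Pi.single i 1 + (1 : ℝ) • Pi.single j 1)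
    have h2 := h (Pi.single i 1 + (-1 : ℝ) • Pi.single j 1)
    rw [hexp, hexp, hs, abs_le] at h1 h2
    rw [abs_le]
    constructor <;> nlinarith [h1.1, h1.2, h2.1, h2.2]
  calc ‖Z‖ = ‖∑ i, ∑ j, Z i j • Matrix.single i j (1 : ℝ)‖ := by
        conv_lhs => rw [Matrix.matrix_eq_sum_single Z]
        simp [Matrix.smul_single]
    _ ≤ ∑ i, ∑ j, ‖Z i j • Matrix.single i j (1 : ℝ)‖ :=
        (norm_sum_le _ _).trans (Finset.sum_le_sum fun i _ => norm_sum_le _ _)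
    _ ≤ ∑ i, ∑ j, ((Y i i + Y j j) / 2 * ‖Matrix.single i j (1 : ℝ)‖) * b := by
        refine Finset.sum_le_sum fun i _ => Finset.sum_le_sum fun j _ => ?_
        rw [norm_smul, Real.norm_eq_abs, mul_right_comm]
        exact mul_le_mul_of_nonneg_right (hentry i j) (norm_nonneg _)
    _ = _ := by simp only [Finset.sum_mul]

/-- Exponential decay of symmetric Lyapunov flows under a strict Lyapunov inequality. -/
lemma exists_exp_bound {A : Matrix ι ι ℝ} {N : κ → Matrix ι ι ℝ} {Y Z₀ : Matrix ι ι ℝ} {c : ℝ}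
    (hY : Y.PosDef) (hL : (-lyap A N Y - c • Y).PosDef) (hZ₀ : Z₀.IsHermitian) :
    ∃ C : ℝ, ∀ Z : ℝ → Matrix ι ι ℝ, Z 0 = Z₀ → (∀ t, 0 ≤ t → (Z t).IsHermitian) →
      (∀ t, 0 ≤ t → HasDerivWithinAt Z (lyap A N (Z t)) (Set.Ici 0) t) →
        ∀ t, 0 ≤ t → ‖Z t‖ ≤ C * Real.exp (-(c * t)) := by
  obtain ⟨K, hK⟩ := exists_norm_le_of_abs_form_le Y
  obtain ⟨ε, hε, hp, hm⟩ := exists_posDef_add_smul hY hZ₀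
  have hinit : ∀ σ : ℝ, (Y + ε • σ • Z₀).PosDef → (ε⁻¹ • Y + σ • Z₀).PosDef := fun σ h => by
    have := h.smul (inv_pos.2 hε)
    rwa [smul_add, smul_smul, inv_mul_cancel₀ hε.ne', one_smul] at this
  refine ⟨K * ε⁻¹, fun Z hZ0 hsymm hZ t ht => ?_⟩
  have hcomp : ∀ σ : ℝ, (Y + ε • σ • Z₀).PosDef →
      ((ε⁻¹ * Real.exp (-(c * t))) • Y + σ • Z t).PosDef := fun σ hσ => by
    refine posDef_of_strict_differential_inequality (A := A) (N := N)
      (D := fun s => (ε⁻¹ * Real.exp (-(c * s))) • Y + σ • Z s)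
      (D' := fun s => (ε⁻¹ * (Real.exp (-(c * s)) * -(c * 1))) • Y + σ • lyap A N (Z s))
      (fun s hs => (hY.1.smul (IsSelfAdjoint.all _)).add ((hsymm s hs).smul (IsSelfAdjoint.all _)))
      ?_ (fun s hs => ?_) (fun s hs => ?_) ht
    · simpa [hZ0] using hinit σ hσ
    · have h1 : HasDerivAt (fun s => ε⁻¹ * Real.exp (-(c * s)))
          (ε⁻¹ * (Real.exp (-(c * s)) * -(c * 1))) s :=
        (((hasDerivAt_id s).const_mul c).neg.exp).const_mul _
      exact (h1.hasDerivWithinAt.smul_const Y).add ((hZ s hs).const_smul σ)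
    · have h1 := hL.smul (mul_pos (inv_pos.2 hε) (Real.exp_pos (-(c * s))))
      convert h1 using 1
      rw [map_add, map_smul, map_smul, smul_sub, smul_smul, smul_neg]
      have : ε⁻¹ * (Real.exp (-(c * s)) * -(c * 1)) = -(ε⁻¹ * Real.exp (-(c * s)) * c) := by ring
      rw [this, neg_smul]
      abel
  have h1 := hcomp 1 (by simpa using hp)
  have h2 := hcomp (-1) (by simpa [sub_eq_add_neg] using hm)
  rw [mul_assoc]
  refine hK (Z t) _ (hsymm t ht) fun w => ?_
  have h3 := h1.posSemidef.dotProduct_mulVec_nonneg w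
  have h4 := h2.posSemidef.dotProduct_mulVec_nonneg w
  rw [star_trivial, Matrix.add_mulVec, dotProduct_add, Matrix.smul_mulVec, Matrix.smul_mulVec,
    dotProduct_smul, dotProduct_smul, smul_eq_mul, smul_eq_mul] at h3 h4
  rw [abs_le]
  constructor <;> linarith

end Decay

/-! ### Lyapunov flows in an invariant subspace -/

section FlowReduction

variable {ι κ ρ : Type*} [Fintype ι] [Fintype κ] [Fintype ρ] [DecidableEq ι] [DecidableEq ρ]

lemma eq_zero_of_norm_deriv_le {E : Type*} [NormedAddCommGroup E] [NormedSpace ℝ E] {f f' : ℝ → E}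
    {K : ℝ} (hf : ∀ t, 0 ≤ t → HasDerivWithinAt f (f' t) (Set.Ici 0) t)
    (hK : ∀ t, 0 ≤ t → ‖f' t‖ ≤ K * ‖f t‖) (h0 : f 0 = 0) {t : ℝ} (ht : 0 ≤ t) : f t = 0 :=
  eq_zero_of_abs_deriv_le_mul_abs_self_of_eq_zero_right (a := 0) (b := t) (f' := f') (K := K)
    (fun s hs => (hf s hs.1).continuousWithinAt.mono Set.Icc_subset_Ici_self)
    (fun s hs => (hf s hs.1).mono (Set.Ici_subset_Ici.2 hs.1)) h0 (fun s hs => hK s hs.1) t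
    ⟨ht, le_rfl⟩

lemma hasDerivWithinAt_linearMap_comp {E F : Type*} [NormedAddCommGroup E] [NormedSpace ℝ E]
    [FiniteDimensional ℝ E] [NormedAddCommGroup F] [NormedSpace ℝ F] (φ : E →ₗ[ℝ] F) {f : ℝ → E}
    {f' : E} {s : Set ℝ} {t : ℝ} (hf : HasDerivWithinAt f f' s t) :
    HasDerivWithinAt (fun t => φ (f t)) (φ f') s t :=
  φ.toContinuousLinearMap.hasFDerivAt.comp_hasDerivWithinAt t hf

lemma isHermitian_of_lyap_flow {A : Matrix ι ι ℝ} {N : κ → Matrix ι ι ℝ} {Z : ℝ → Matrix ι ι ℝ}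
    (h0 : (Z 0).IsHermitian)
    (hZ : ∀ t, 0 ≤ t → HasDerivWithinAt Z (lyap A N (Z t)) (Set.Ici 0) t) {t : ℝ} (ht : 0 ≤ t) :
    (Z t).IsHermitian := by
  have hd : ∀ s, 0 ≤ s → HasDerivWithinAt (fun s => (Z s)ᴴ - Z s)
      (lyap A N ((Z s)ᴴ - Z s)) (Set.Ici 0) s := fun s hs => by
    rw [map_sub, ← lyap_conjTranspose]
    let φ : Matrix ι ι ℝ →ₗ[ℝ] Matrix ι ι ℝ :=
      { toFun := fun M => Mᴴ
        map_add' := Matrix.conjTranspose_add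
        map_smul' := fun c M => by simp }
    exact (hasDerivWithinAt_linearMap_comp φ (hZ s hs)).sub (hZ s hs)
  exact sub_eq_zero.1 (eq_zero_of_norm_deriv_le hd
    (fun s _ => (lyap A N).toContinuousLinearMap.le_opNorm _) (by rw [h0.eq, sub_self]) ht)

/-- The Lyapunov flow started inside an invariant subspace stays there: if the range of `V` is
invariant and contains the range of `Z 0`, then `V Vᵀ Z t = Z t`. -/
lemma projection_mul_lyap_flow {A : Matrix ι ι ℝ} {N : κ → Matrix ι ι ℝ} {V : Matrix ι ρ ℝ}
    {A' : Matrix ρ ρ ℝ} {N' : κ → Matrix ρ ρ ℝ} {Z : ℝ → Matrix ι ι ℝ} (hV : Vᵀ * V = 1)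
    (hA : A * V = V * A') (hN : ∀ k, N k * V = V * N' k) (h0 : V * Vᵀ * Z 0 = Z 0)
    (hZ : ∀ t, 0 ≤ t → HasDerivWithinAt Z (lyap A N (Z t)) (Set.Ici 0) t) {t : ℝ} (ht : 0 ≤ t) :
    V * Vᵀ * Z t = Z t := by
  set Q := 1 - V * Vᵀ with hQ
  have hQV : Q * V = 0 := by
    rw [hQ, Matrix.sub_mul, Matrix.one_mul, Matrix.mul_assoc, hV, Matrix.mul_one, sub_self]
  -- `Q` annihilates the subspace, so `Q B = Q B Q` for every `B` leaving it invariant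
  have hQB : ∀ (B : Matrix ι ι ℝ) (B' : Matrix ρ ρ ℝ), B * V = V * B' →
      Q * B = Q * B * Q := fun B B' hB => by
    have h1 : Q * B * (V * Vᵀ) = 0 := by
      rw [Matrix.mul_assoc, ← Matrix.mul_assoc B, hB, Matrix.mul_assoc V, ← Matrix.mul_assoc Q,
        hQV, Matrix.zero_mul]
    conv_rhs => rw [hQ]
    rw [Matrix.mul_sub, ← hQ, h1, sub_zero, Matrix.mul_one]
  let T : Matrix ι ι ℝ →ₗ[ℝ] Matrix ι ι ℝ :=
    { toFun := fun R => Q * A * R + R * Aᴴ + ∑ k, Q * N k * R * (N k)ᴴ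
      map_add' := fun R R' => by
        simp only [Matrix.mul_add, Matrix.add_mul, Finset.sum_add_distrib]
        abel
      map_smul' := fun c R => by
        simp only [Matrix.mul_smul, Matrix.smul_mul, smul_add, Finset.smul_sum,
          RingHom.id_apply] }
  have hd : ∀ s, 0 ≤ s → HasDerivWithinAt (fun s => Q * Z s) (T (Q * Z s)) (Set.Ici 0) s :=
    fun s hs => by
      have h1 := hasDerivWithinAt_linearMap_comp (LinearMap.mulLeft ℝ Q) (hZ s hs)
      have h2 : Q * lyap A N (Z s) = T (Q * Z s) := by
        change Q * (A * Z s + Z s * Aᴴ + ∑ k, N k * Z s * (N k)ᴴ) =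
          Q * A * (Q * Z s) + Q * Z s * Aᴴ + ∑ k, Q * N k * (Q * Z s) * (N k)ᴴ
        simp only [← Matrix.mul_assoc]
        rw [← hQB A A' hA]
        simp only [← fun k => hQB (N k) (N' k) (hN k), Matrix.mul_add, Matrix.mul_sum,
          Matrix.mul_assoc]
      rw [← h2]
      exact h1
  have h3 : Q * Z t = 0 := eq_zero_of_norm_deriv_le hd
    (fun s _ => T.toContinuousLinearMap.le_opNorm _)
    (by rw [hQ, Matrix.sub_mul, Matrix.one_mul, h0, sub_self]) ht
  rw [hQ, Matrix.sub_mul, Matrix.one_mul, sub_eq_zero] at h3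
  exact h3.symm

omit [DecidableEq ι] [DecidableEq ρ] in
lemma lyap_mul_mul_transpose {A : Matrix ι ι ℝ} {N : κ → Matrix ι ι ℝ} {V : Matrix ι ρ ℝ}
    {A' : Matrix ρ ρ ℝ} {N' : κ → Matrix ρ ρ ℝ} (hA : A * V = V * A')
    (hN : ∀ k, N k * V = V * N' k) (Y : Matrix ρ ρ ℝ) :
    lyap A N (V * Y * Vᵀ) = V * lyap A' N' Y * Vᵀ := by
  have ht : ∀ (B : Matrix ι ι ℝ) (B' : Matrix ρ ρ ℝ), B * V = V * B' → Vᵀ * Bᵀ = B'ᵀ * Vᵀ :=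
    fun B B' h => by rw [← Matrix.transpose_mul, h, Matrix.transpose_mul]
  simp only [lyap_apply, Matrix.conjTranspose_eq_transpose_of_trivial, Matrix.mul_add,
    Matrix.add_mul, Matrix.mul_sum, Matrix.sum_mul]
  congr 1
  · congr 1
    · rw [← Matrix.mul_assoc, ← Matrix.mul_assoc, hA]
      simp only [Matrix.mul_assoc]
    · simp only [Matrix.mul_assoc, ht A A' hA]
  · refine Finset.sum_congr rfl fun k _ => ?_
    rw [← Matrix.mul_assoc, ← Matrix.mul_assoc, hN]
    simp only [Matrix.mul_assoc, ht (N k) (N' k) (hN k)]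

/-- Lyapunov flows started inside an invariant subspace decay exponentially as soon as the Lyapunov
operator of the subspace satisfies a strict Lyapunov inequality. -/
lemma exists_exp_bound_of_invariant {A : Matrix ι ι ℝ} {N : κ → Matrix ι ι ℝ} {V : Matrix ι ρ ℝ}
    {A' : Matrix ρ ρ ℝ} {N' : κ → Matrix ρ ρ ℝ} (hV : Vᵀ * V = 1)
    (hA : A * V = V * A') (hN : ∀ k, N k * V = V * N' k) {Y : Matrix ρ ρ ℝ} {c : ℝ}
    (hY : Y.PosDef) (hL : (-lyap A' N' Y - c • Y).PosDef) {Z₀ : Matrix ι ι ℝ}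
    (hZ₀ : Z₀.IsHermitian) (hVZ₀ : V * Vᵀ * Z₀ = Z₀) :
    ∃ C : ℝ, ∀ Z : ℝ → Matrix ι ι ℝ, Z 0 = Z₀ →
      (∀ t, 0 ≤ t → HasDerivWithinAt Z (lyap A N (Z t)) (Set.Ici 0) t) →
        ∀ t, 0 ≤ t → ‖Z t‖ ≤ C * Real.exp (-(c * t)) := by
  have hconj : ∀ M : Matrix ι ι ℝ, M.IsHermitian → (Vᵀ * M * V).IsHermitian := fun M hM => by
    have := Matrix.isHermitian_conjTranspose_mul_mul V hM
    rwa [Matrix.conjTranspose_eq_transpose_of_trivial] at this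
  obtain ⟨C, hC⟩ := exists_exp_bound hY hL (hconj Z₀ hZ₀)
  refine ⟨‖V‖ * C * ‖Vᵀ‖, fun Z hZ0 hZ t ht => ?_⟩
  have hsymm : ∀ s, 0 ≤ s → (Z s).IsHermitian := fun s hs =>
    isHermitian_of_lyap_flow (by rwa [hZ0]) hZ hs
  have hrep : ∀ s, 0 ≤ s → Z s = V * (Vᵀ * Z s * V) * Vᵀ := fun s hs => by
    have h1 := projection_mul_lyap_flow hV hA hN (by rwa [hZ0]) hZ hs
    have h2 : Z s * (V * Vᵀ) = Z s := by
      have := congrArg Matrix.transpose h1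
      have hs' : (Z s)ᵀ = Z s := by simpa [Matrix.IsHermitian] using hsymm s hs
      rwa [Matrix.transpose_mul, Matrix.transpose_mul, Matrix.transpose_transpose, hs'] at this
    calc Z s = V * Vᵀ * (Z s * (V * Vᵀ)) := by rw [h2, h1]
      _ = _ := by simp only [Matrix.mul_assoc]
  let φ : Matrix ι ι ℝ →ₗ[ℝ] Matrix ρ ρ ℝ :=
    { toFun := fun M => Vᵀ * M * V
      map_add' := fun M M' => by rw [Matrix.mul_add, Matrix.add_mul]
      map_smul' := fun a M => by rw [Matrix.mul_smul, Matrix.smul_mul, RingHom.id_apply] }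
  have hflow : ∀ s, 0 ≤ s → HasDerivWithinAt (fun s => Vᵀ * Z s * V)
      (lyap A' N' (Vᵀ * Z s * V)) (Set.Ici 0) s := fun s hs => by
    have h1 := hasDerivWithinAt_linearMap_comp φ (hZ s hs)
    have h2 : φ (lyap A N (Z s)) = lyap A' N' (Vᵀ * Z s * V) := by
      change Vᵀ * lyap A N (Z s) * V = _
      conv_lhs => rw [hrep s hs, lyap_mul_mul_transpose hA hN]
      rw [Matrix.mul_assoc V, ← Matrix.mul_assoc Vᵀ, hV, Matrix.one_mul, Matrix.mul_assoc, hV,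
        Matrix.mul_one]
    rw [h2] at h1
    exact h1
  have hb := hC (fun s => Vᵀ * Z s * V) (by simp only [hZ0]) (fun s hs => hconj _ (hsymm s hs))
    hflow t ht
  calc ‖Z t‖ = ‖V * (Vᵀ * Z t * V) * Vᵀ‖ := by rw [← hrep t ht]
    _ ≤ ‖V‖ * ‖Vᵀ * Z t * V‖ * ‖Vᵀ‖ :=
        (Matrix.l2_opNorm_mul _ _).trans
          (mul_le_mul_of_nonneg_right (Matrix.l2_opNorm_mul _ _) (norm_nonneg _))
    _ ≤ ‖V‖ * (C * Real.exp (-(c * t))) * ‖Vᵀ‖ := by gcongr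
    _ = _ := by ring

end FlowReduction

/-! ### Uniqueness for the bilinear integral equation -/

section Volterra

/-- A continuous function dominated by the integral of its norm against an integrable kernel
vanishes. -/
lemma eq_zero_of_norm_le_integral {E : Type*} [NormedAddCommGroup E] {a : ℝ → ℝ} {y : ℝ → E}
    (ha0 : ∀ t, 0 ≤ a t) (ha : ∀ t, 0 ≤ t → IntervalIntegrable a volume 0 t)
    (hy : ContinuousOn y (Set.Ici 0))
    (hle : ∀ t, 0 ≤ t → ‖y t‖ ≤ ∫ v in (0 : ℝ)..t, a v * ‖y v‖) {t : ℝ} (ht : 0 ≤ t) :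
    y t = 0 := by
  have hint : ∀ s₁ s₂, 0 ≤ s₁ → 0 ≤ s₂ → IntervalIntegrable a volume s₁ s₂ := fun s₁ s₂ h₁ h₂ =>
    (ha s₁ h₁).symm.trans (ha s₂ h₂)
  have hyc : ∀ s₁ s₂, 0 ≤ s₁ → 0 ≤ s₂ → ContinuousOn (fun v => ‖y v‖) (Set.uIcc s₁ s₂) :=
    fun s₁ s₂ h₁ h₂ => hy.norm.mono fun v hv => (le_min h₁ h₂).trans hv.1
  have hcl : IsClosed ({s | y s = 0} ∩ Set.Icc 0 t) := by
    have := (hy.mono Set.Icc_subset_Ici_self).preimage_isClosed_of_isClosed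
      (isClosed_Icc (a := (0 : ℝ)) (b := t)) (isClosed_singleton (x := (0 : E)))
    rwa [Set.inter_comm] at this
  have h0 : (0 : ℝ) ∈ {s | y s = 0} := by
    have := hle 0 le_rfl
    rw [intervalIntegral.integral_same] at this
    exact norm_le_zero_iff.1 this
  refine hcl.Icc_subset_of_forall_mem_nhdsGT_of_Icc_subset h0 (fun s hs hprev => ?_) ⟨ht, le_rfl⟩
  -- just to the right of `s` the kernel has mass less than `1 / 2`
  have hcont : Filter.Tendsto (fun τ => ∫ v in s..τ, a v) (nhdsWithin s (Set.Ioc s t))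
      (nhds 0) := by
    have h1 : ContinuousOn (fun τ => ∫ v in s..τ, a v) (Set.Icc s t) := by
      have := intervalIntegral.continuousOn_primitive_interval (μ := volume) (f := a) (a := s)
        (b := t) (by
          have := (intervalIntegrable_iff_integrableOn_Icc_of_le hs.2.le).1
            (hint s t hs.1 ht)
          rwa [Set.uIcc_of_le hs.2.le])
      rwa [Set.uIcc_of_le hs.2.le] at this
    have h2 := (h1 s ⟨le_rfl, hs.2.le⟩).mono Set.Ioc_subset_Icc_self
    simpa [ContinuousWithinAt] using h2
  rw [nhdsWithin_Ioc_eq_nhdsGT hs.2] at hcont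
  obtain ⟨τ, hτ, hsτ, hτt⟩ := ((hcont.eventually
    (gt_mem_nhds (show (0 : ℝ) < 1 / 2 by norm_num))).and (Ioc_mem_nhdsGT hs.2)).exists
  obtain ⟨x, hx, hmax⟩ := isCompact_Icc.exists_isMaxOn (Set.nonempty_Icc.2 hsτ.le)
    (hy.norm.mono fun v (hv : v ∈ Set.Icc s τ) => hs.1.trans hv.1)
  have hx0 : 0 ≤ x := hs.1.trans hx.1
  have hbound : ‖y x‖ ≤ 1 / 2 * ‖y x‖ := by
    calc ‖y x‖ ≤ ∫ v in (0 : ℝ)..x, a v * ‖y v‖ := hle x hx0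
      _ = (∫ v in (0 : ℝ)..s, a v * ‖y v‖) + ∫ v in s..x, a v * ‖y v‖ :=
          (intervalIntegral.integral_add_adjacent_intervals
            ((hint _ _ le_rfl hs.1).mul_continuousOn (hyc _ _ le_rfl hs.1))
            ((hint _ _ hs.1 hx0).mul_continuousOn (hyc _ _ hs.1 hx0))).symm
      _ = ∫ v in s..x, a v * ‖y v‖ := by
          rw [intervalIntegral.integral_congr (g := fun _ => (0 : ℝ)),
            intervalIntegral.integral_zero, zero_add]
          intro v hv
          rw [Set.uIcc_of_le hs.1] at hv
          simp [show y v = 0 from hprev hv]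
      _ ≤ ∫ v in s..x, a v * ‖y x‖ := by
          refine intervalIntegral.integral_mono_on hx.1
            ((hint _ _ hs.1 hx0).mul_continuousOn (hyc _ _ hs.1 hx0))
            ((hint _ _ hs.1 hx0).mul_const _) fun v hv => ?_
          exact mul_le_mul_of_nonneg_left (hmax ⟨hv.1, hv.2.trans hx.2⟩) (ha0 v)
      _ = (∫ v in s..x, a v) * ‖y x‖ := intervalIntegral.integral_mul_const _ _
      _ ≤ (∫ v in s..τ, a v) * ‖y x‖ := by
          refine mul_le_mul_of_nonneg_right ?_ (norm_nonneg _)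
          exact intervalIntegral.integral_mono_interval le_rfl hx.1 hx.2
            (Filter.Eventually.of_forall ha0) (hint _ _ hs.1 (hs.1.trans hsτ.le))
      _ ≤ 1 / 2 * ‖y x‖ := mul_le_mul_of_nonneg_right hτ.le (norm_nonneg _)
  have hyx : ‖y x‖ ≤ 0 := by linarith
  filter_upwards [Ioc_mem_nhdsGT hsτ] with v hv
  exact norm_le_zero_iff.1 ((hmax ⟨hv.1.le, hv.2⟩).trans hyx)

lemma IsL2Control.intervalIntegrable {m : ℕ} {u : ℝ → EuclideanSpace ℝ (Fin m)}
    (hu : IsL2Control u) (k : Fin m) {t : ℝ} (ht : 0 ≤ t) :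
    IntervalIntegrable (fun v => u v k) volume 0 t := by
  rw [intervalIntegrable_iff_integrableOn_Ioc_of_le ht]
  have h1 : MemLp u 2 (volume.restrict (Set.Ioc 0 t)) :=
    MemLp.mono_measure (Measure.restrict_mono (fun x hx => hx.1.le) le_rfl) hu
  have h2 : Integrable u (volume.restrict (Set.Ioc 0 t)) := h1.integrable (by norm_num)
  exact (EuclideanSpace.proj (𝕜 := ℝ) k).integrable_comp h2

/-- A linear map applied to the integral equation of the fundamental solution. -/
lemma IsFundamentalSolution.linearMap_apply {n m p q : ℕ} {A : Matrix (Fin n) (Fin n) ℝ}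
    {N : Fin m → Matrix (Fin n) (Fin n) ℝ} {u : ℝ → EuclideanSpace ℝ (Fin m)}
    {Φ : ℝ → Matrix (Fin n) (Fin n) ℝ} (hΦ : IsFundamentalSolution A N u 0 Φ)
    (hu : IsL2Control u) (φ : Matrix (Fin n) (Fin n) ℝ →ₗ[ℝ] Matrix (Fin p) (Fin q) ℝ) {t : ℝ}
    (ht : 0 ≤ t) :
    φ (Φ t) = φ 1 + (∫ v in (0 : ℝ)..t, φ (A * Φ v)) +
      ∑ k, ∫ v in (0 : ℝ)..t, u v k • φ (N k * Φ v) := by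
  have hc : ∀ B : Matrix (Fin n) (Fin n) ℝ, ContinuousOn (fun v => B * Φ v) (Set.uIcc 0 t) :=
    fun B => (continuousOn_const.mul hΦ.1).mono (by
      rw [Set.uIcc_of_le ht]; exact Set.Icc_subset_Ici_self)
  have h1 := φ.toContinuousLinearMap.intervalIntegral_comp_comm 
    ((hc A).intervalIntegrable (μ := volume))
  have h2 := fun k => φ.toContinuousLinearMap.intervalIntegral_comp_comm
    ((hu.intervalIntegrable k ht).smul_continuousOn (hc (N k)))
  simp only [LinearMap.coe_toContinuousLinearMap', map_smul] at h1 h2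
  rw [h1]
  simp only [h2]
  conv_lhs => rw [hΦ.2 t ht]
  rw [map_add, map_add, map_sum]

/-- Reduction of the bilinear system to an invariant subspace containing the initial states. -/
lemma IsFundamentalSolution.mul_eq_of_invariant {n m q r : ℕ} {A : Matrix (Fin n) (Fin n) ℝ}
    {N : Fin m → Matrix (Fin n) (Fin n) ℝ} {A' : Matrix (Fin r) (Fin r) ℝ}
    {N' : Fin m → Matrix (Fin r) (Fin r) ℝ} {V : Matrix (Fin n) (Fin r) ℝ}
    {X₀ : Matrix (Fin n) (Fin q) ℝ} {X₀' : Matrix (Fin r) (Fin q) ℝ}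
    (hA : A * V = V * A') (hN : ∀ k, N k * V = V * N' k) (hX₀ : X₀ = V * X₀')
    {u : ℝ → EuclideanSpace ℝ (Fin m)} (hu : IsL2Control u)
    {Φ : ℝ → Matrix (Fin n) (Fin n) ℝ} {Φr : ℝ → Matrix (Fin r) (Fin r) ℝ}
    (hΦ : IsFundamentalSolution A N u 0 Φ) (hΦr : IsFundamentalSolution A' N' u 0 Φr) {t : ℝ}
    (ht : 0 ≤ t) : Φ t * X₀ = V * Φr t * X₀' := by
  let φ : Matrix (Fin n) (Fin n) ℝ →ₗ[ℝ] Matrix (Fin n) (Fin q) ℝ :=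
    { toFun := fun M => M * X₀
      map_add' := fun M M' => by rw [Matrix.add_mul]
      map_smul' := fun a M => by rw [Matrix.smul_mul, RingHom.id_apply] }
  let ψ : Matrix (Fin r) (Fin r) ℝ →ₗ[ℝ] Matrix (Fin n) (Fin q) ℝ :=
    { toFun := fun M => V * M * X₀'
      map_add' := fun M M' => by rw [Matrix.mul_add, Matrix.add_mul]
      map_smul' := fun a M => by rw [Matrix.mul_smul, Matrix.smul_mul, RingHom.id_apply] }
  set y : ℝ → Matrix (Fin n) (Fin q) ℝ := fun s => φ (Φ s) - ψ (Φr s) with hy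
  have hφc : ContinuousOn (fun s => φ (Φ s)) (Set.Ici 0) :=
    φ.toContinuousLinearMap.continuous.comp_continuousOn hΦ.1
  have hψc : ContinuousOn (fun s => ψ (Φr s)) (Set.Ici 0) :=
    ψ.toContinuousLinearMap.continuous.comp_continuousOn hΦr.1
  have hyc : ContinuousOn y (Set.Ici 0) := hφc.sub hψc
  have hmulc : ∀ (B : Matrix (Fin n) (Fin n) ℝ) (f : ℝ → Matrix (Fin n) (Fin q) ℝ),
      ContinuousOn f (Set.Ici 0) → ∀ s, 0 ≤ s → ContinuousOn (fun v => B * f v) (Set.uIcc 0 s) :=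
    fun B f hf s hs => by
      have h1 : Continuous fun M : Matrix (Fin n) (Fin q) ℝ => B * M :=
        Continuous.matrix_mul continuous_const continuous_id
      exact (h1.comp_continuousOn hf).mono (by
        rw [Set.uIcc_of_le hs]; exact Set.Icc_subset_Ici_self)
  have hint : ∀ s, 0 ≤ s → y s = (∫ v in (0 : ℝ)..s, A * y v) +
      ∑ k, ∫ v in (0 : ℝ)..s, u v k • (N k * y v) := fun s hs => by
    have e1 := hΦ.linearMap_apply hu φ hs
    have e2 := hΦr.linearMap_apply hu ψ hs
    have f1 : ∀ (B M : Matrix (Fin n) (Fin n) ℝ), φ (B * M) = B * φ M := fun B M =>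
      Matrix.mul_assoc B M X₀
    have f2 : ∀ (B : Matrix (Fin n) (Fin n) ℝ) (B' M : Matrix (Fin r) (Fin r) ℝ),
        B * V = V * B' → ψ (B' * M) = B * ψ M := fun B B' M h => by
      change V * (B' * M) * X₀' = B * (V * M * X₀')
      rw [← Matrix.mul_assoc, ← h]
      simp only [Matrix.mul_assoc]
    have f3 : φ 1 = ψ 1 := by
      change (1 : Matrix (Fin n) (Fin n) ℝ) * X₀ = V * (1 : Matrix (Fin r) (Fin r) ℝ) * X₀'
      rw [Matrix.one_mul, Matrix.mul_one, hX₀]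
    simp only [f1] at e1
    simp only [f2 A A' _ hA, fun k M => f2 (N k) (N' k) M (hN k)] at e2
    simp only [hy, Matrix.mul_sub, smul_sub]
    rw [e1, e2, f3, intervalIntegral.integral_sub (hmulc A _ hφc s hs).intervalIntegrable
      (hmulc A _ hψc s hs).intervalIntegrable]
    have e3 : ∀ k, ∫ v in (0 : ℝ)..s, (u v k • (N k * φ (Φ v)) - u v k • (N k * ψ (Φr v))) =
        (∫ v in (0 : ℝ)..s, u v k • (N k * φ (Φ v))) -
          ∫ v in (0 : ℝ)..s, u v k • (N k * ψ (Φr v)) := fun k =>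
      intervalIntegral.integral_sub
        ((hu.intervalIntegrable k hs).smul_continuousOn (hmulc (N k) _ hφc s hs))
        ((hu.intervalIntegrable k hs).smul_continuousOn (hmulc (N k) _ hψc s hs))
    simp only [e3, Finset.sum_sub_distrib]
    abel
  have haint : ∀ s, 0 ≤ s → IntervalIntegrable (fun v => ‖A‖ + ∑ k, |u v k| * ‖N k‖) volume 0 s :=
    fun s hs => (intervalIntegrable_const (c := ‖A‖)).add
      (by
        have := IntervalIntegrable.sum Finset.univ (f := fun k v => |u v k| * ‖N k‖)
          fun k _ => ((hu.intervalIntegrable k hs).abs).mul_const ‖N k‖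
        simpa only [Finset.sum_fn] using this)
  have hnorm : ∀ s, 0 ≤ s →
      ‖y s‖ ≤ ∫ v in (0 : ℝ)..s, (‖A‖ + ∑ k, |u v k| * ‖N k‖) * ‖y v‖ := fun s hs => by
    have hIA := (hmulc A y hyc s hs).intervalIntegrable (μ := volume)
    have hIN := fun k => (hu.intervalIntegrable k hs).smul_continuousOn (hmulc (N k) y hyc s hs)
    have hsum := IntervalIntegrable.sum Finset.univ (f := fun k v => u v k • (N k * y v))
        fun k _ => hIN k
    have e : y s = ∫ v in (0 : ℝ)..s, (A * y v + ∑ k, u v k • (N k * y v)) := by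
      rw [intervalIntegral.integral_add hIA (by simpa only [Finset.sum_fn] using hsum),
        intervalIntegral.integral_finsetSum fun k _ => hIN k]
      exact hint s hs
    conv_lhs => rw [e]
    refine intervalIntegral.norm_integral_le_of_norm_le hs
      (Filter.Eventually.of_forall fun v _ => ?_)
      ((haint s hs).mul_continuousOn (hyc.norm.mono (by
        rw [Set.uIcc_of_le hs]; exact Set.Icc_subset_Ici_self)))
    refine (norm_add_le _ _).trans ?_
    rw [add_mul, Finset.sum_mul]
    refine add_le_add (Matrix.l2_opNorm_mul _ _) ((norm_sum_le _ _).trans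
      (Finset.sum_le_sum fun k _ => ?_))
    rw [norm_smul, Real.norm_eq_abs, mul_assoc]
    exact mul_le_mul_of_nonneg_left (Matrix.l2_opNorm_mul _ _) (abs_nonneg _)
  have hfin : y t = 0 := eq_zero_of_norm_le_integral
    (fun v => add_nonneg (norm_nonneg _) (Finset.sum_nonneg fun k _ => by positivity)) haint hyc
    hnorm ht
  exact sub_eq_zero.1 hfin

end Volterra

end BilinearSystem

theorem theorem2p4 {n m q : ℕ} (A : Matrix (Fin n) (Fin n) ℝ)
    (N : Fin m → Matrix (Fin n) (Fin n) ℝ) (X₀ : Matrix (Fin n) (Fin q) ℝ)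
    (γ : ℝ) (hγ : 0 < γ)
    (hX : ∃ X : Matrix (Fin n) (Fin n) ℝ, X.PosDef ∧
      (-(X₀ * X₀ᵀ) - BilinearSystem.lyapunovOp A N γ X).PosSemidef) :
    -- stability
    BilinearSystem.complexSpectrum (BilinearSystem.kroneckerOp A N γ) ⊆
        closure BilinearSystem.leftHalfPlane ∧
    -- exponential decay from the initial condition `X₀ X₀ᵀ`
    (∃ c : ℝ, 0 < c ∧ ∃ C : ℝ, ∀ Z : ℝ → Matrix (Fin n) (Fin n) ℝ,
      BilinearSystem.IsLyapunovFlow A N γ (X₀ * X₀ᵀ) Z →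
        ∀ t : ℝ, 0 ≤ t → ‖Z t‖ ≤ C * Real.exp (-(c * t))) ∧
    -- asymptotically stable projected system without reduction error
    (∃ (r : ℕ) (V : Matrix (Fin n) (Fin r) ℝ), r ≤ n ∧ Vᵀ * V = 1 ∧
      BilinearSystem.complexSpectrum
          (BilinearSystem.kroneckerOp (Vᵀ * A * V) (fun k => Vᵀ * N k * V) γ) ⊆
        BilinearSystem.leftHalfPlane ∧
      ∀ u : ℝ → EuclideanSpace ℝ (Fin m), BilinearSystem.IsL2Control u →
        ∀ (Φ : ℝ → Matrix (Fin n) (Fin n) ℝ) (Φr : ℝ → Matrix (Fin r) (Fin r) ℝ),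
          BilinearSystem.IsFundamentalSolution A N u 0 Φ →
          BilinearSystem.IsFundamentalSolution (Vᵀ * A * V) (fun k => Vᵀ * N k * V) u 0 Φr →
          ∀ t : ℝ, 0 ≤ t → Φ t * X₀ = V * Φr t * (Vᵀ * X₀)) := by
  obtain ⟨X, hX, hL⟩ := hX
  rw [BilinearSystem.lyapunovOp_eq_lyap] at hL
  refine ⟨fun z hz => ?_, ?_⟩
  · obtain ⟨M, hM, hz⟩ := BilinearSystem.exists_eigenvector_of_mem_complexSpectrum hz
    rw [BilinearSystem.leftHalfPlane, Complex.closure_setOfPred_re_lt]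
    by_contra hcon
    have hre : 0 < z.re := not_le.1 hcon
    exact hre.ne' (BilinearSystem.exists_invariant_of_eigenvalue hX hL hM hz hre.le).1
  obtain ⟨r, V, hr, hV, hA, hN, hX₀, hmin⟩ :=
    BilinearSystem.exists_reachable_coordinates A N X₀
  have hNγ : ∀ k, (γ⁻¹ • N k) * V = V * (γ⁻¹ • (Vᵀ * N k * V)) := fun k => by
    rw [Matrix.smul_mul, Matrix.mul_smul, hN]
  obtain ⟨X', hX', hL'⟩ :=
    BilinearSystem.exists_reduced_lyapunov_inequality hX hL hV hA hNγ hX₀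
  -- minimality of the subspace excludes eigenvalues in the closed right half-plane
  have hneg : ∀ (z : ℂ) (M : Matrix (Fin r) (Fin r) ℂ), M ≠ 0 →
      BilinearSystem.lyap ((Vᵀ * A * V).map Complex.ofReal)
        (fun k => (γ⁻¹ • (Vᵀ * N k * V)).map Complex.ofReal) M = z • M → z.re < 0 :=
    fun z M hM hz => by
      by_contra hcon
      obtain ⟨-, G, hG, hGA, hGN, hGX⟩ :=
        BilinearSystem.exists_invariant_of_eigenvalue hX' hL' hM hz (not_lt.1 hcon)
      refine hG (hmin G hGA (fun k w hw => ?_) hGX)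
      have := G.smul_mem γ (hGN k w hw)
      rwa [Matrix.smul_mulVec, smul_smul, mul_inv_cancel₀ hγ.ne', one_smul] at this
  have hstable : BilinearSystem.complexSpectrum
      (BilinearSystem.kroneckerOp (Vᵀ * A * V) (fun k => Vᵀ * N k * V) γ) ⊆
        BilinearSystem.leftHalfPlane := fun z hz => by
    obtain ⟨M, hM, hz⟩ := BilinearSystem.exists_eigenvector_of_mem_complexSpectrum hz
    exact hneg z M hM hz
  refine ⟨?_, r, V, hr, hV, hstable, fun u hu Φ Φr hΦ hΦr t ht =>
    hΦ.mul_eq_of_invariant hA hN hX₀ hu hΦr ht⟩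
  have hXX : (Vᵀ * X₀ * (Vᵀ * X₀)ᵀ).PosSemidef := by
    simpa using Matrix.posSemidef_self_mul_conjTranspose (Vᵀ * X₀)
  have hL'' := hL'.add hXX
  rw [sub_add_eq_add_sub, neg_add_cancel, zero_sub] at hL''
  -- injectivity of the reduced operator: `0` is not an eigenvalue
  obtain ⟨Y, c, hc, hY, hLY⟩ := BilinearSystem.exists_strict_lyapunov hX' hL'' (by
    rw [← LinearMap.ker_eq_bot, LinearMap.ker_eq_bot']
    intro M hM
    by_contra hM0
    have h0 : M.map Complex.ofReal ≠ 0 := fun h => hM0 (by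
      ext i j
      simpa using congrFun (congrFun h i) j)
    refine lt_irrefl _ (hneg 0 _ h0 ?_)
    rw [← BilinearSystem.lyap_map_ofReal, hM, zero_smul]
    ext
    simp)
  obtain ⟨C, hC⟩ := BilinearSystem.exists_exp_bound_of_invariant hV hA hNγ hY hLY
    (Z₀ := X₀ * X₀ᵀ) (by
      rw [Matrix.IsHermitian, Matrix.conjTranspose_eq_transpose_of_trivial, Matrix.transpose_mul,
        Matrix.transpose_transpose])
    (by rw [← Matrix.mul_assoc, Matrix.mul_assoc V, ← hX₀])
  refine ⟨c, hc, C, fun Z hZ => hC Z hZ.1 fun t ht => ?_⟩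
  rw [← BilinearSystem.lyapunovOp_eq_lyap]
  exact hZ.2 t ht
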